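/- Let $n\ge 0$, let $K$ be a field and let $t\in K$ be such that $1+t+\dots+t^{j-1}\neq 0$ for $1\le j\le n$ (for instance $K=\mathbb{Q}(t)$ with $t$ an indeterminate). Let $x_1,\dots,x_n,y_1,\dots,y_n$ be indeterminates. For a partition $\lambda=(\lambda_1\ge\dots\ge\lambda_n\ge 0)$ with at most $n$ nonzero parts let $m_i(\lambda)$, $i\ge 0$, be the number of indices $k\in\{1,\dots,n\}$ with $\lambda_k=i$ (so that zero parts are counted, up to a total of $n$ parts), and let $$P_\lambda(x_1,\dots,x_n;t)=\frac{1}{v_\lambda(t)}\sum_{\sigma\in S_n}\sigma\left(x_1^{\lambda_1}\cdots x_n^{\lambda_n}\prod_{1\le i<j\le n}\frac{x_i-tx_j}{x_i-x_j}\right),\qquad v_\lambda(t)=\prod_{i\ge 0}\prod_{j=1}^{m_i(\lambda)}\frac{1-t^j}{1-t},$$ be the Hall–Littlewood polynomial, where $\frac{1-t^j}{1-t}$ stands for $1+t+\dots+t^{j-1}$. Put $\Delta(x)_n=\prod_{1\le i<j\le n}(x_i-x_j)$. Then the sum over all such partitions on the left-hand side below converges in the ring of formal power series $K[[x_1,\dots,x_n,y_1,\dots,y_n]]$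 (each coefficient of the sum involves only finitely many $\lambda$), and in the fraction field of this ring $$\sum_{\lambda}\prod_{i=0}^{\infty}\prod_{j=1}^{m_i(\lambda)}(1-t^j)\,P_\lambda(x_1,\dots,x_n;t)\,P_\lambda(y_1,\dots,y_n;t)=\frac{\prod_{i,j=1}^n(1-tx_iy_j)}{\Delta(x)_n\,\Delta(y)_n}\,\det\left[\frac{1-t}{(1-x_iy_j)(1-tx_iy_j)}\right]_{1\le i,j\le n}.$$ -/

import Mathlib

open scoped MvPowerSeries.WithPiTopology

/-- Partitions `lam = (lam 0 ≥ lam 1 ≥ … ≥ lam (n-1) ≥ 0)` with at most `n` nonzero parts, written as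
weakly decreasing sequences of exactly `n` parts, zero parts included. -/
abbrev PartitionLE (n : ℕ) : Type := {lam : Fin n → ℕ // Antitone lam}

/-- `m_i(lam)`: the number of parts of `lam` (among its `n` parts, zero parts included) equal
to `i`. -/
def partMult {n : ℕ} (lam : PartitionLE n) (i : ℕ) : ℕ :=
  (Finset.univ.filter fun k : Fin n => lam.1 k = i).card

/-- `∏_{i ≥ 0} ∏_{j=1}^{m_i(lam)} (1 - t^j)`. The outer product is written over the finite set of
values `i` of parts of `lam` (zero parts included): for any other `i ≥ 0` one has `m_i(lam) = 0` and
the factor is an empty product. -/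
def hlWeight {K : Type*} [Field K] {n : ℕ} (t : K) (lam : PartitionLE n) : K :=
  ∏ i ∈ Finset.univ.image lam.1, ∏ j ∈ Finset.Icc 1 (partMult lam i), (1 - t ^ j)

/-- `v_lam(t) = ∏_{i ≥ 0} ∏_{j=1}^{m_i(lam)} (1 - t^j) / (1 - t)`, where the polynomial
`(1 - t^j) / (1 - t)` in `t` is written as `1 + t + ⋯ + t^(j-1)`, so that `t = 1` makes sense. -/
def hlNorm {K : Type*} [Field K] {n : ℕ} (t : K) (lam : PartitionLE n) : K :=
  ∏ i ∈ Finset.univ.image lam.1, ∏ j ∈ Finset.Icc 1 (partMult lam i), ∑ k ∈ Finset.range j, t ^ k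

/-- The Vandermonde product `Δ(x)_n = ∏_{i<j} (x_i - x_j)`. -/
def vdm {R : Type*} [CommRing R] {n : ℕ} (x : Fin n → R) : R :=
  ∏ i, ∏ j ∈ Finset.Ioi i, (x i - x j)

/-- The symmetrization formula
`(1 / v_lam(t)) ∑_{σ ∈ S_n} σ (x_1^{lam_1} ⋯ x_n^{lam_n} ∏_{i<j} (x_i - t x_j) / (x_i - x_j))`,
in a field `L` over `K` that contains the variables `x_1, …, x_n`. -/
noncomputable def hlFormula {K L : Type*} [Field K] [Field L] [Algebra K L] {n : ℕ} (t : K)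
    (lam : PartitionLE n) (x : Fin n → L) : L :=
  1 / algebraMap K L (hlNorm t lam) *
    ∑ σ : Equiv.Perm (Fin n),
      (∏ i, x (σ i) ^ lam.1 i) *
        ∏ i, ∏ j ∈ Finset.Ioi i,
          (x (σ i) - algebraMap K L t * x (σ j)) / (x (σ i) - x (σ j))

namespace HLAux

open MvPolynomial

variable {K : Type*} [Field K] {n : ℕ}

/-- The variables `X a` and `X b` agree modulo their difference. -/
theorem mk_X_eq (a b : Fin n) :
    Ideal.Quotient.mkₐ K (Ideal.span {(X a - X b : MvPolynomial (Fin n) K)}) (X a) =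
      Ideal.Quotient.mkₐ K (Ideal.span {(X a - X b : MvPolynomial (Fin n) K)}) (X b) :=
  Ideal.Quotient.eq.2 (Ideal.subset_span rfl)

/-- A permutation that exchanges two variables acts trivially modulo their difference. -/
theorem mk_rename_swap (a b : Fin n) (p : MvPolynomial (Fin n) K) :
    Ideal.Quotient.mkₐ K (Ideal.span {(X a - X b : MvPolynomial (Fin n) K)})
      (rename (Equiv.swap a b) p) =
    Ideal.Quotient.mkₐ K (Ideal.span {(X a - X b : MvPolynomial (Fin n) K)}) p := by
  have hab := mk_X_eq (K := K) a b
  have h : ((Ideal.Quotient.mkₐ K (Ideal.span {(X a - X b : MvPolynomial (Fin n) K)})).comp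
      (rename (Equiv.swap a b))) =
      Ideal.Quotient.mkₐ K (Ideal.span {(X a - X b : MvPolynomial (Fin n) K)}) := by
    apply MvPolynomial.algHom_ext
    intro c
    simp only [AlgHom.comp_apply, rename_X]
    rcases eq_or_ne c a with rfl | hca
    · rw [Equiv.swap_apply_left, hab]
    rcases eq_or_ne c b with rfl | hcb
    · rw [Equiv.swap_apply_right, hab]
    · rw [Equiv.swap_apply_of_ne_of_ne hca hcb]
  exact DFunLike.congr_fun h p

/-- An antisymmetrized polynomial is divisible by each `X a - X b`. -/
theorem sub_dvd_antisymm {a b : Fin n} (hab : a ≠ b) (g : MvPolynomial (Fin n) K) :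
    (X a - X b : MvPolynomial (Fin n) K) ∣
      ∑ σ : Equiv.Perm (Fin n), ((Equiv.Perm.sign σ : ℤ) : MvPolynomial (Fin n) K) * rename σ g := by
  rw [← Ideal.mem_span_singleton, ← Ideal.Quotient.eq_zero_iff_mem]
  change Ideal.Quotient.mkₐ K _ _ = 0
  rw [map_sum]
  refine Finset.sum_involution (fun σ _ => Equiv.swap a b * σ) ?_ ?_ ?_ ?_
  · intro σ _
    have h : rename (Equiv.swap a b * σ : Equiv.Perm (Fin n)) g =
        rename (Equiv.swap a b) (rename σ g) := by
      rw [rename_rename]; rfl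
    rw [h, map_mul, map_mul, mk_rename_swap, Equiv.Perm.sign_mul, Equiv.Perm.sign_swap hab]
    simp
  · intro σ _ _ h
    have h1 : Equiv.swap a b = 1 := by simpa using h
    exact hab (Equiv.swap_eq_one_iff.1 h1)
  · intro σ _; exact Finset.mem_univ _
  · intro σ _; simp [← mul_assoc]

/-- A difference of two distinct variables is prime. -/
theorem prime_sub {a b : Fin n} (hab : a ≠ b) : Prime (X a - X b : MvPolynomial (Fin n) K) := by
  have hne : (X a - X b : MvPolynomial (Fin n) K) ≠ 0 := by
    rw [sub_ne_zero]; exact fun h => hab (X_injective h)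
  rw [← Ideal.span_singleton_prime hne]
  obtain ⟨φ, hφ⟩ : ∃ φ : MvPolynomial (Fin n) K →ₐ[K] MvPolynomial (Fin n) K,
      ∀ c, φ (X c) = if c = a then X b else X c :=
    ⟨aeval fun c => if c = a then X b else X c, fun c => by rw [aeval_X]⟩
  have hk : RingHom.ker (φ : MvPolynomial (Fin n) K →+* MvPolynomial (Fin n) K) = Ideal.span {(X a - X b : MvPolynomial (Fin n) K)} := by
    apply le_antisymm
    · intro p hp
      have h : (Ideal.Quotient.mkₐ K (Ideal.span {(X a - X b : MvPolynomial (Fin n) K)})).comp φ =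
          Ideal.Quotient.mkₐ K (Ideal.span {(X a - X b : MvPolynomial (Fin n) K)}) := by
        apply MvPolynomial.algHom_ext
        intro c
        simp only [AlgHom.comp_apply, hφ]
        split_ifs with hc
        · rw [hc]
          exact (mk_X_eq a b).symm
        · rfl
      have h2 := DFunLike.congr_fun h p
      rw [AlgHom.comp_apply, (RingHom.mem_ker.1 hp : φ p = 0), map_zero] at h2
      exact Ideal.Quotient.eq_zero_iff_mem.1 h2.symm
    · rw [Ideal.span_le, Set.singleton_subset_iff]
      change φ _ = 0
      rw [map_sub, hφ, hφ, if_pos rfl, if_neg hab.symm, sub_self]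
  rw [← hk]
  exact RingHom.ker_isPrime _

theorem not_sub_dvd_sub {a b c d : Fin n} (hab : a < b) (hcd : c < d) (h : (a, b) ≠ (c, d)) :
    ¬ (X a - X b : MvPolynomial (Fin n) K) ∣ X c - X d := by
  rintro ⟨q, hq⟩
  have key : ∀ e : Fin n, e ≠ a → e ≠ b → e ≠ c ∧ e ≠ d := by
    intro e hea heb
    have h2 := congrArg (eval fun k => if k = e then (1 : K) else 0) hq
    simp only [map_mul, map_sub, eval_X, if_neg hea.symm, if_neg heb.symm, sub_self,
      zero_mul] at h2
    constructor
    · rintro rfl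
      simp [hcd.ne'] at h2
    · rintro rfl
      simp [hcd.ne] at h2
  have hc : c = a ∨ c = b := by
    by_contra! hc
    exact (key c hc.1 hc.2).1 rfl
  have hd : d = a ∨ d = b := by
    by_contra! hd
    exact (key d hd.1 hd.2).2 rfl
  rcases hc with rfl | rfl <;> rcases hd with rfl | rfl
  · exact hcd.ne rfl
  · exact h rfl
  · exact absurd hab hcd.asymm
  · exact hcd.ne rfl

/-- An antisymmetrized polynomial is divisible by the Vandermonde product. -/
theorem vdm_dvd_antisymm (g : MvPolynomial (Fin n) K) :
    vdm (X : Fin n → MvPolynomial (Fin n) K) ∣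
      ∑ σ : Equiv.Perm (Fin n), ((Equiv.Perm.sign σ : ℤ) : MvPolynomial (Fin n) K) * rename σ g := by
  unfold vdm
  rw [Finset.prod_sigma']
  refine Finset.prod_dvd_of_isRelPrime ?_ ?_
  · rintro ⟨a, b⟩ hab ⟨c, d⟩ hcd h
    simp only [Finset.coe_sigma, Set.mem_sigma_iff, Finset.coe_univ, Set.mem_univ, Finset.coe_Ioi,
      Set.mem_Ioi, true_and] at hab hcd
    refine (prime_sub hab.ne).irreducible.isRelPrime_iff_not_dvd.2 (not_sub_dvd_sub hab hcd ?_)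
    rintro h2
    apply h
    cases h2
    rfl
  · rintro ⟨a, b⟩ hab
    simp only [Finset.mem_sigma, Finset.mem_univ, Finset.mem_Ioi, true_and] at hab
    exact sub_dvd_antisymm hab.ne g

/-- The symmetrization formula, evaluated in the field of rational functions in the variables,
is a polynomial. -/
theorem exists_polynomial (t : K) (lam : PartitionLE n) :
    ∃ P : MvPolynomial (Fin n) K,
      algebraMap (MvPolynomial (Fin n) K) (FractionRing (MvPolynomial (Fin n) K)) P =
        hlFormula t lam fun i =>
          algebraMap (MvPolynomial (Fin n) K) (FractionRing (MvPolynomial (Fin n) K)) (X i) := by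
  set f := algebraMap (MvPolynomial (Fin n) K) (FractionRing (MvPolynomial (Fin n) K)) with hf
  have hinj : Function.Injective f := IsFractionRing.injective _ _
  let g : MvPolynomial (Fin n) K := (∏ i, X i ^ lam.1 i) * ∏ i, ∏ j ∈ Finset.Ioi i, (X i - C t * X j)
  obtain ⟨q, hq⟩ := vdm_dvd_antisymm g
  have hK : ∀ s : K, algebraMap K (FractionRing (MvPolynomial (Fin n) K)) s = f (C s) := fun s => rfl
  have hV : f (vdm (X : Fin n → MvPolynomial (Fin n) K)) ≠ 0 := by
    rw [Ne, map_eq_zero_iff f hinj]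
    unfold vdm
    refine Finset.prod_ne_zero_iff.2 fun i _ => Finset.prod_ne_zero_iff.2 fun j hij => ?_
    exact (prime_sub (Finset.mem_Ioi.1 hij).ne).ne_zero
  refine ⟨C (1 / hlNorm t lam) * q, ?_⟩
  unfold hlFormula
  rw [map_mul, ← hK, map_div₀, map_one]
  congr 1
  rw [← mul_right_inj' hV, ← map_mul, ← hq, map_sum, Finset.mul_sum]
  refine Finset.sum_congr rfl fun σ _ => ?_
  have hs : ∏ i, ∏ j ∈ Finset.Ioi i, (f (X (σ i)) - f (X (σ j))) =
      ((Equiv.Perm.sign σ : ℤ) : FractionRing (MvPolynomial (Fin n) K)) * f (vdm (X : Fin n → MvPolynomial (Fin n) K)) := by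
    rw [Equiv.Perm.prod_Ioi_comp_eq_sign_mul_prod σ (f := fun i j => f (X i) - f (X j)) (by simp)]
    simp [vdm, map_prod]
  have hsq : ((Equiv.Perm.sign σ : ℤ) : FractionRing (MvPolynomial (Fin n) K)) * ((Equiv.Perm.sign σ : ℤ) :
      FractionRing (MvPolynomial (Fin n) K)) = 1 := by
    rw [← Int.cast_mul, ← Units.val_mul, Int.units_mul_self]; simp
  have hV' : f (vdm (X : Fin n → MvPolynomial (Fin n) K)) =
      ((Equiv.Perm.sign σ : ℤ) : FractionRing (MvPolynomial (Fin n) K)) *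
        ∏ i, ∏ j ∈ Finset.Ioi i, (f (X (σ i)) - f (X (σ j))) := by
    rw [hs, ← mul_assoc, hsq, one_mul]
  have hne : ∏ i, ∏ j ∈ Finset.Ioi i, (f (X (σ i)) - f (X (σ j))) ≠ 0 := by
    intro h0
    rw [hV', h0, mul_zero] at hV
    exact hV rfl
  have hg : f (rename σ g) = (∏ i, f (X (σ i)) ^ lam.1 i) *
      ∏ i, ∏ j ∈ Finset.Ioi i, (f (X (σ i)) - f (C t) * f (X (σ j))) := by
    simp [g, map_prod]
  rw [map_mul, hg, hV', map_intCast]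
  simp only [Finset.prod_div_distrib, hK]
  field_simp

end HLAux

/-- The Hall–Littlewood polynomial `P_lam(x_1, …, x_n; t)`: the polynomial over `K` given by the
symmetrization formula in the field of rational functions. -/
noncomputable def hallLittlewood {K : Type*} [Field K] {n : ℕ} (t : K) (lam : PartitionLE n) :
    MvPolynomial (Fin n) K :=
  Classical.choose (HLAux.exists_polynomial t lam)

/-- The property that characterizes the Hall–Littlewood polynomial. -/
theorem hallLittlewood_spec {K : Type*} [Field K] {n : ℕ} (t : K) (lam : PartitionLE n) :
    algebraMap (MvPolynomial (Fin n) K) (FractionRing (MvPolynomial (Fin n) K))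
        (hallLittlewood t lam) =
      hlFormula t lam fun i =>
        algebraMap (MvPolynomial (Fin n) K) (FractionRing (MvPolynomial (Fin n) K))
          (MvPolynomial.X i) :=
  Classical.choose_spec (HLAux.exists_polynomial t lam)

/-- The ring `K⟦x_1, …, x_n, y_1, …, y_n⟧` of formal power series in two sets of `n` variables:
`Sum.inl i` indexes `x_i` and `Sum.inr j` indexes `y_j`. -/
abbrev SeriesXY (K : Type*) (n : ℕ) : Type _ := MvPowerSeries (Fin n ⊕ Fin n) K

/-- `P(x_1, …, x_n)` as a formal power series in the variables `x, y`. -/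
noncomputable def inX {K : Type*} [Field K] {n : ℕ} (P : MvPolynomial (Fin n) K) : SeriesXY K n :=
  (MvPolynomial.rename (Sum.inl : Fin n → Fin n ⊕ Fin n) P : MvPolynomial (Fin n ⊕ Fin n) K)

/-- `P(y_1, …, y_n)` as a formal power series in the variables `x, y`. -/
noncomputable def inY {K : Type*} [Field K] {n : ℕ} (P : MvPolynomial (Fin n) K) : SeriesXY K n :=
  (MvPolynomial.rename (Sum.inr : Fin n → Fin n ⊕ Fin n) P : MvPolynomial (Fin n ⊕ Fin n) K)

/-- The field of fractions of the ring of formal power series in the variables `x, y`. -/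
abbrev FracXY (K : Type*) [Field K] (n : ℕ) : Type _ := FractionRing (SeriesXY K n)

/-- The variable `x_i` in the field of fractions. -/
noncomputable def xVar (K : Type*) [Field K] {n : ℕ} (i : Fin n) : FracXY K n :=
  algebraMap (SeriesXY K n) (FracXY K n) (MvPowerSeries.X (Sum.inl i))

/-- The variable `y_j` in the field of fractions. -/
noncomputable def yVar (K : Type*) [Field K] {n : ℕ} (j : Fin n) : FracXY K n :=
  algebraMap (SeriesXY K n) (FracXY K n) (MvPowerSeries.X (Sum.inr j))

/-- The parameter `t` in the field of fractions. -/
noncomputable def tConst {K : Type*} [Field K] (n : ℕ) (t : K) : FracXY K n :=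
  algebraMap (SeriesXY K n) (FracXY K n) (MvPowerSeries.C t)

/-- The closed form
`∏_{i,j} (1 - t x_i y_j) / (Δ(x)_n Δ(y)_n) * det [(1 - t) / ((1 - x_i y_j) (1 - t x_i y_j))]`
for elements `t, x_i, y_j` of a field. -/
noncomputable def izerginForm {L : Type*} [Field L] {n : ℕ} (t : L) (x y : Fin n → L) : L :=
  (∏ i, ∏ j, (1 - t * x i * y j)) / (vdm x * vdm y) *
    (Matrix.of fun i j : Fin n => (1 - t) / ((1 - x i * y j) * (1 - t * x i * y j))).det

/-! Write `[k] = 1 + t + ⋯ + t^(k-1)` and `[k]! = [1]⋯[k]`, and let `A_λ` be the symmetrization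
without its factor `1 / v_λ`. The weight of `λ` is `(1 - t)^n v_λ`, so the left-hand side is `(1 -
t)^n F(X, Y)` with `F(X, Y) = ∑_λ A_λ(X) A_λ(Y) / v_λ`.

Write `λ` as a partition `μ` with `r` parts, each raised by one, followed by `k` zeros. Then `v_λ =
[k]! v_μ`, and `A_λ(X) = [k]! ∑_I c(I, X) (∏ I) A_μ(I)` over the `r`-element subsets `I` of `X`,
where `c(I, X) = ∏_{i ∈ I, j ∉ I} (i - t j) / (i - j)` (`hlSym_extendParts`). Hence `F(X, Y) = ∑_{I,
J} [n - |I|]! c(I, X) c(J, Y) (∏ I) (∏ J) F(I, J)`, where `F` is zero on sets of different sizes;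
for truncated sums this is `hlPartialSum_succ`. A nonempty `I` brings a factor `∏ I` of positive
order, so two solutions that agree at the empty sets differ by terms of arbitrarily high order
(`exists_fracOrderGE_izFin_sub`). It remains to see that the determinantal form solves the
recurrence (`hlSum_izFin`).

This is done by partial fractions, for a family with a parameter `k`: `[m]!` becomes `[m + k]!`, the
matrix entry becomes `([k+1] - t [k] z) / ((1 - z)(1 - t z))`, and the determinantal side gets a
factor `[k]!`. As functions of one `x`, both sides are a constant plus simple fractions at the
inverses of the `y`'s, and their residues agree by induction on the number of variables. Their
difference is therefore constant, and that `x` may be moved to `0`; by symmetry so may one `y`. With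
a zero on each side, the identity for `(n + 1, k)` becomes the one for `(n, k + 1)`, which is why
the parameter is needed. -/

/-! ### Partial fractions, as identities between values -/

/-- On `U \ T`, the function `f` is a constant plus the simple fractions `ρ s / (z - s)`, `s ∈ T`. -/
def HasSimplePoles {L : Type*} [Field L] (U : Set L) (T : Finset L) (f ρ : L → L) : Prop :=
  ∃ c, ∀ z ∈ U, z ∉ T → f z = c + ∑ s ∈ T, ρ s / (z - s)

namespace HasSimplePoles

variable {L : Type*} [Field L] {U V : Set L} {T T' : Finset L} {f g ρ ρ' : L → L}

theorem congr (h : HasSimplePoles U T f ρ) (hf : ∀ z ∈ U, z ∉ T → g z = f z)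
    (hρ : ∀ s ∈ T, ρ' s = ρ s) : HasSimplePoles U T g ρ' := by
  obtain ⟨c, hc⟩ := h
  refine ⟨c, fun z hz hzT => ?_⟩
  rw [hf z hz hzT, hc z hz hzT]
  congr 1
  exact Finset.sum_congr rfl fun s hs => by rw [hρ s hs]

theorem mono_set (h : HasSimplePoles U T f ρ) (hV : V ⊆ U) : HasSimplePoles V T f ρ := by
  obtain ⟨c, hc⟩ := h
  exact ⟨c, fun z hz => hc z (hV hz)⟩

theorem const (c : L) : HasSimplePoles U T (fun _ => c) (fun _ => 0) :=
  ⟨c, fun z _ _ => by simp⟩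

theorem extend (h : HasSimplePoles U T f ρ) (hT : T ⊆ T') (h1 : ∀ s ∈ T, ρ' s = ρ s)
    (h0 : ∀ s ∈ T', s ∉ T → ρ' s = 0) : HasSimplePoles U T' f ρ' := by
  obtain ⟨c, hc⟩ := h
  refine ⟨c, fun z hz hzT => ?_⟩
  rw [hc z hz fun h => hzT (hT h), ← Finset.sum_subset hT]
  · congr 1
    exact Finset.sum_congr rfl fun s hs => by rw [h1 s hs]
  · intro s hs hs'
    rw [h0 s hs hs', zero_div]

/-- Poles with zero residue may be dropped. -/
theorem shrink (h : HasSimplePoles U T' f ρ) (hT : T ⊆ T') (h0 : ∀ s ∈ T', s ∉ T → ρ s = 0)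
    (hU : ∀ z ∈ U, z ∈ T' → z ∈ T) : HasSimplePoles U T f ρ := by
  obtain ⟨c, hc⟩ := h
  refine ⟨c, fun z hz hzT => ?_⟩
  rw [hc z hz fun h => hzT (hU z hz h), ← Finset.sum_subset hT]
  intro s hs hs'
  rw [h0 s hs hs', zero_div]

theorem smul (a : L) (h : HasSimplePoles U T f ρ) :
    HasSimplePoles U T (fun z => a * f z) (fun s => a * ρ s) := by
  obtain ⟨c, hc⟩ := h
  refine ⟨a * c, fun z hz hzT => ?_⟩
  simp only [hc z hz hzT, mul_add, Finset.mul_sum, mul_div_assoc]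

theorem add (hf : HasSimplePoles U T f ρ) (hg : HasSimplePoles U T g ρ') :
    HasSimplePoles U T (fun z => f z + g z) (fun s => ρ s + ρ' s) := by
  obtain ⟨c, hc⟩ := hf
  obtain ⟨d, hd⟩ := hg
  refine ⟨c + d, fun z hz hzT => ?_⟩
  simp only [hc z hz hzT, hd z hz hzT, add_div, Finset.sum_add_distrib]
  ring

theorem sum {ι : Type*} (A : Finset ι) {F R : ι → L → L}
    (h : ∀ i ∈ A, HasSimplePoles U T (F i) (R i)) :
    HasSimplePoles U T (fun z => ∑ i ∈ A, F i z) (fun s => ∑ i ∈ A, R i s) := by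
  classical
  induction A using Finset.induction_on with
  | empty => simpa using const 0
  | insert i A hi ih =>
    simp only [Finset.sum_insert hi]
    exact (h i (Finset.mem_insert_self i A)).add
      (ih fun j hj => h j (Finset.mem_insert_of_mem hj))

/-- Two functions with the same poles and residues differ by a constant. -/
theorem sub_eq_sub (hf : HasSimplePoles U T f ρ) (hg : HasSimplePoles U T g ρ) {z w : L}
    (hz : z ∈ U) (hzT : z ∉ T) (hw : w ∈ U) (hwT : w ∉ T) : f z - g z = f w - g w := by
  obtain ⟨c, hc⟩ := hf
  obtain ⟨d, hd⟩ := hg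
  rw [hc z hz hzT, hd z hz hzT, hc w hw hwT, hd w hw hwT]
  ring

/-- The product of two functions with disjoint sets of simple poles. -/
theorem mul [DecidableEq L] (hf : HasSimplePoles U T f ρ) (hg : HasSimplePoles V T' g ρ')
    (hT : Disjoint T T') (hTV : ∀ s ∈ T, s ∈ V) (hTU : ∀ s ∈ T', s ∈ U) :
    HasSimplePoles (U ∩ V) (T ∪ T') (fun z => f z * g z)
      (fun s => if s ∈ T then ρ s * g s else ρ' s * f s) := by
  obtain ⟨c, hc⟩ := hf
  obtain ⟨d, hd⟩ := hg
  refine ⟨c * d, fun z hz hzT => ?_⟩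
  rw [Finset.mem_union, not_or] at hzT
  rw [Finset.sum_union hT]
  have e1 : ∀ s ∈ T, (if s ∈ T then ρ s * g s else ρ' s * f s) / (z - s) =
      d * (ρ s / (z - s)) + ∑ r ∈ T', ρ s * ρ' r / ((s - r) * (z - s)) := by
    intro s hs
    rw [if_pos hs, hd s (hTV s hs) (Finset.disjoint_left.1 hT hs), mul_add, add_div,
      Finset.mul_sum, Finset.sum_div]
    congr 1
    · ring
    · exact Finset.sum_congr rfl fun r _ => by rw [← mul_div_assoc, div_div]
  have e2 : ∀ r ∈ T', (if r ∈ T then ρ r * g r else ρ' r * f r) / (z - r) =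
      c * (ρ' r / (z - r)) + ∑ s ∈ T, ρ s * ρ' r / ((r - s) * (z - r)) := by
    intro r hr
    have hrT := Finset.disjoint_right.1 hT hr
    rw [if_neg hrT, hc r (hTU r hr) hrT, mul_add, add_div, Finset.mul_sum, Finset.sum_div]
    congr 1
    · ring
    · exact Finset.sum_congr rfl fun s _ => by
        rw [← mul_div_assoc, div_div, mul_comm (ρ' r)]
  rw [Finset.sum_congr rfl e1, Finset.sum_congr rfl e2, Finset.sum_add_distrib,
    Finset.sum_add_distrib, ← Finset.mul_sum, ← Finset.mul_sum, Finset.sum_comm (s := T') (t := T)]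
  -- Termwise: `1 / ((z - s)(z - r)) = 1 / ((s - r)(z - s)) + 1 / ((r - s)(z - r))`, which needs the
  -- pole sets to be disjoint.
  have key : (∑ s ∈ T, ρ s / (z - s)) * ∑ r ∈ T', ρ' r / (z - r) =
      (∑ s ∈ T, ∑ r ∈ T', ρ s * ρ' r / ((s - r) * (z - s))) +
      ∑ s ∈ T, ∑ r ∈ T', ρ s * ρ' r / ((r - s) * (z - r)) := by
    rw [Finset.sum_mul_sum, ← Finset.sum_add_distrib]
    refine Finset.sum_congr rfl fun s hs => ?_
    rw [← Finset.sum_add_distrib]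
    refine Finset.sum_congr rfl fun r hr => ?_
    have h1 : z - s ≠ 0 := sub_ne_zero.2 fun h => hzT.1 (h ▸ hs)
    have h2 : z - r ≠ 0 := sub_ne_zero.2 fun h => hzT.2 (h ▸ hr)
    have h3 : s - r ≠ 0 := sub_ne_zero.2 fun h => Finset.disjoint_left.1 hT hs (h ▸ hr)
    have h4 : r - s = -(s - r) := by ring
    rw [h4]
    field_simp
    ring
  beta_reduce
  rw [hc z hz.1 hzT.1, hd z hz.2 hzT.2, add_mul, mul_add, mul_add, key]
  ring

/-- A quotient of two products of linear forms of the same length. -/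
theorem prod_div {κ : Type*} [DecidableEq L] (Q : Finset κ) (T : Finset L)
    (hQ : Q.card = T.card) (α β : κ → L) :
    HasSimplePoles Set.univ T (fun z => (∏ q ∈ Q, (α q + β q * z)) / ∏ p ∈ T, (z - p))
      (fun s => (∏ q ∈ Q, (α q + β q * s)) / ∏ p ∈ T.erase s, (s - p)) := by
  classical
  induction T using Finset.induction_on generalizing Q with
  | empty =>
    rw [Finset.card_empty, Finset.card_eq_zero] at hQ
    subst hQ
    exact (const (1 : L)).congr (by simp) (by simp)
  | insert p T hp ih =>
    rw [Finset.card_insert_of_notMem hp] at hQ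
    -- Equal lengths allow each pole to be paired with one linear form, so that no polynomial part
    -- of positive degree arises.
    obtain ⟨q, hq⟩ : Q.Nonempty := Finset.card_pos.1 (by omega)
    have h1 : HasSimplePoles Set.univ {p} (fun z => (α q + β q * z) / (z - p))
        (fun s => α q + β q * s) := by
      refine ⟨β q, fun z _ hz => ?_⟩
      have : z - p ≠ 0 := sub_ne_zero.2 (by simpa using hz)
      rw [Finset.sum_singleton]
      field_simp
      ring
    have h2 := ih (Q.erase q) (by rw [Finset.card_erase_of_mem hq]; omega)
    have h3 := h1.mul h2 (by simpa using hp) (by simp) (by simp)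
    rw [Set.inter_self, ← Finset.insert_eq] at h3
    refine h3.congr (fun z _ hz => ?_) (fun s hs => ?_)
    · simp only [Finset.prod_insert hp, ← Finset.mul_prod_erase Q _ hq]
      rw [div_mul_div_comm]
    · by_cases hsp : s = p
      · subst hsp
        rw [if_pos (Finset.mem_singleton_self s), Finset.erase_insert hp,
          ← Finset.mul_prod_erase Q _ hq, mul_div_assoc]
      · rw [if_neg (by simpa using hsp), Finset.erase_insert_of_ne (Ne.symm hsp),
          Finset.prod_insert (fun h => hp (Finset.mem_of_mem_erase h)),
          ← Finset.mul_prod_erase Q _ hq, div_mul_div_comm, mul_comm, mul_comm (s - p)]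

end HasSimplePoles

/-! ### The determinantal form for tuples: symmetry, Laplace expansion, zero variables -/

/-- `1 + t + ⋯ + t ^ (k - 1)`. -/
def qNat {L : Type*} [Field L] (t : L) (k : ℕ) : L := ∑ i ∈ Finset.range k, t ^ i

/-- `∏_{j=1}^k (1 + t + ⋯ + t ^ (j - 1))`. -/
def qFact {L : Type*} [Field L] (t : L) (k : ℕ) : L := ∏ j ∈ Finset.range k, qNat t (j + 1)

/-- The function `([k+1] - t [k] z) / ((1 - z) (1 - t z))`. -/
def izEntry {L : Type*} [Field L] (t : L) (k : ℕ) (z : L) : L :=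
  (qNat t (k + 1) - t * qNat t k * z) / ((1 - z) * (1 - t * z))

/-- The determinant of `izEntry t k (x i * y j)`, normalized by its obvious factors. -/
noncomputable def izRatio {L : Type*} [Field L] (t : L) (k : ℕ) {n : ℕ} (x y : Fin n → L) : L :=
  (∏ i, ∏ j, (1 - t * x i * y j)) / (vdm x * vdm y) *
    (Matrix.of fun i j : Fin n => izEntry t k (x i * y j)).det

section Laplace

variable {L : Type*} [Field L]

theorem qNat_succ (t : L) (k : ℕ) : qNat t (k + 1) = 1 + t * qNat t k := by
  simp only [qNat, Finset.sum_range_succ', pow_succ', Finset.mul_sum, pow_zero]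
  ring

theorem qFact_succ (t : L) (k : ℕ) : qFact t (k + 1) = qFact t k * qNat t (k + 1) :=
  Finset.prod_range_succ _ _

theorem vdm_comp_perm {n : ℕ} (x : Fin n → L) (σ : Equiv.Perm (Fin n)) :
    vdm (x ∘ σ) = ((Equiv.Perm.sign σ : ℤ) : L) * vdm x := by
  unfold vdm
  have h := Equiv.Perm.prod_Ioi_comp_eq_sign_mul_prod σ (f := fun i j => x i - x j) (by simp)
  simpa using h

theorem vdm_cons {n : ℕ} (z : L) (x : Fin n → L) :
    vdm (Fin.cons z x : Fin (n + 1) → L) = (∏ i, (z - x i)) * vdm x := by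
  simp [vdm, Fin.prod_univ_succ, Fin.prod_Ioi_succ]

/-- Bringing the entry `j` to the front is a cycle of sign `(-1) ^ j`. -/
theorem vdm_succAbove {n : ℕ} (y : Fin (n + 1) → L) (j : Fin (n + 1)) :
    (-1) ^ (j : ℕ) * vdm y =
      (∏ k, (y j - y (j.succAbove k))) * vdm (y ∘ j.succAbove) := by
  have h : (Fin.cons (y j) (y ∘ j.succAbove) : Fin (n + 1) → L) =
      y ∘ (Fin.cycleRange j).symm := by
    funext i
    refine Fin.cases ?_ (fun k => ?_) i
    · simp
    · simp
  have h2 := vdm_cons (y j) (y ∘ j.succAbove)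
  rw [h, vdm_comp_perm] at h2
  simpa [Fin.sign_cycleRange] using h2

theorem perm_sign_cast_mul_self {n : ℕ} (σ : Equiv.Perm (Fin n)) :
    ((Equiv.Perm.sign σ : ℤ) : L) * ((Equiv.Perm.sign σ : ℤ) : L) = 1 := by
  rw [← Int.cast_mul, ← Units.val_mul, Int.units_mul_self]; simp

theorem izRatio_swap (t : L) (k : ℕ) {n : ℕ} (x y : Fin n → L) :
    izRatio t k x y = izRatio t k y x := by
  unfold izRatio
  rw [← Matrix.det_transpose, Finset.prod_comm, mul_comm (vdm x)]
  congr 2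
  · exact Finset.prod_congr rfl fun i _ => Finset.prod_congr rfl fun j _ => by ring
  · ext i j
    simp [mul_comm]

theorem izRatio_comp_left (t : L) (k : ℕ) {n : ℕ} (x y : Fin n → L) (σ : Equiv.Perm (Fin n)) :
    izRatio t k (x ∘ σ) y = izRatio t k x y := by
  unfold izRatio
  have h1 : (Matrix.of fun i j : Fin n => izEntry t k ((x ∘ σ) i * y j)) =
      (Matrix.of fun i j : Fin n => izEntry t k (x i * y j)).submatrix σ id := by
    ext i j; rfl
  have h2 : ∏ i, ∏ j, (1 - t * (x ∘ σ) i * y j) = ∏ i, ∏ j, (1 - t * x i * y j) :=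
    Equiv.prod_comp σ fun i => ∏ j, (1 - t * x i * y j)
  rw [h1, h2, vdm_comp_perm, Matrix.det_permute]
  have hs := perm_sign_cast_mul_self (L := L) σ
  have hinv : (((Equiv.Perm.sign σ : ℤ) : L))⁻¹ = ((Equiv.Perm.sign σ : ℤ) : L) :=
    inv_eq_of_mul_eq_one_right hs
  rw [div_eq_mul_inv, div_eq_mul_inv, mul_assoc ((Equiv.Perm.sign σ : ℤ) : L), mul_inv, hinv]
  linear_combination (∏ i, ∏ j, (1 - t * x i * y j)) * (vdm x * vdm y)⁻¹ *
    (Matrix.of fun i j : Fin n => izEntry t k (x i * y j)).det * hs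

theorem izRatio_comp_right (t : L) (k : ℕ) {n : ℕ} (x y : Fin n → L) (σ : Equiv.Perm (Fin n)) :
    izRatio t k x (y ∘ σ) = izRatio t k x y := by
  rw [izRatio_swap, izRatio_comp_left, izRatio_swap]

/-- Laplace expansion along the first row, with minors in normalized form. -/
theorem det_izEntry_cons (t : L) (k : ℕ) {n : ℕ} (z : L) (x : Fin n → L)
    (y : Fin (n + 1) → L) :
    (Matrix.of fun i j : Fin (n + 1) =>
        izEntry t k ((Fin.cons z x : Fin (n + 1) → L) i * y j)).det *
      ((∏ i, ∏ j, (1 - t * x i * y j)) / (vdm x * vdm y)) =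
    ∑ j, izEntry t k (z * y j) *
      ((∏ i, (1 - t * x i * y j)) / (∏ l, (y j - y (j.succAbove l))) *
        izRatio t k x (y ∘ j.succAbove)) := by
  rw [Matrix.det_succ_row_zero, Finset.sum_mul]
  refine Finset.sum_congr rfl fun j _ => ?_
  have hm : (Matrix.of fun i j : Fin (n + 1) =>
      izEntry t k ((Fin.cons z x : Fin (n + 1) → L) i * y j)).submatrix Fin.succ j.succAbove =
      Matrix.of fun i l : Fin n => izEntry t k (x i * (y ∘ j.succAbove) l) := by
    ext i l; simp
  have hp : ∏ i, ∏ l, (1 - t * x i * y l) = (∏ i, (1 - t * x i * y j)) *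
      ∏ i, ∏ l, (1 - t * x i * (y ∘ j.succAbove) l) := by
    rw [← Finset.prod_mul_distrib]
    exact Finset.prod_congr rfl fun i _ => Fin.prod_univ_succAbove _ j
  have hv := vdm_succAbove y j
  have hs : ((-1 : L) ^ (j : ℕ)) * (-1) ^ (j : ℕ) = 1 := by
    rw [← mul_pow]; simp
  have hv' : vdm y = (-1) ^ (j : ℕ) *
      ((∏ l, (y j - y (j.succAbove l))) * vdm (y ∘ j.succAbove)) := by
    rw [← hv, ← mul_assoc, hs, one_mul]
  have hinv : ((-1 : L) ^ (j : ℕ))⁻¹ = (-1) ^ (j : ℕ) :=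
    inv_eq_of_mul_eq_one_right hs
  rw [hm, hp, hv', izRatio]
  simp only [Matrix.of_apply, Fin.cons_zero, div_eq_mul_inv, mul_inv, hinv]
  generalize (Matrix.of fun i l : Fin n => izEntry t k (x i * (y ∘ j.succAbove) l)).det = D
  linear_combination (izEntry t k (z * y j) * D * (∏ i, (1 - t * x i * y j)) *
    (∏ i, ∏ l, (1 - t * x i * (y ∘ j.succAbove) l)) * (vdm x)⁻¹ *
    (∏ l, (y j - y (j.succAbove l)))⁻¹ * (vdm (y ∘ j.succAbove))⁻¹) * hs

theorem izRatio_cons (t : L) (k : ℕ) {n : ℕ} (z : L) (x : Fin n → L)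
    (y : Fin (n + 1) → L) :
    izRatio t k (Fin.cons z x : Fin (n + 1) → L) y =
      (∏ j, (1 - t * z * y j)) / (∏ i, (z - x i)) * ∑ j, izEntry t k (z * y j) *
        ((∏ i, (1 - t * x i * y j)) / (∏ l, (y j - y (j.succAbove l))) *
          izRatio t k x (y ∘ j.succAbove)) := by
  rw [← det_izEntry_cons t k z x y, izRatio, vdm_cons, Fin.prod_univ_succ]
  simp only [Fin.cons_zero, Fin.cons_succ, div_eq_mul_inv, mul_inv]
  ring

/-- This is the expansion of a determinant with a repeated row. It is the reason why the closed form
has no pole where a new variable meets an old one. -/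
theorem sum_izEntry_eq_zero (t : L) (k : ℕ) {n : ℕ} (x : Fin n → L) (i : Fin n)
    (y : Fin (n + 1) → L) :
    ∑ j, izEntry t k (x i * y j) *
      ((∏ i, (1 - t * x i * y j)) / (∏ l, (y j - y (j.succAbove l))) *
        izRatio t k x (y ∘ j.succAbove)) = 0 := by
  rw [← det_izEntry_cons t k (x i) x y, Matrix.det_zero_of_row_eq (i := 0) (j := i.succ),
    zero_mul]
  · exact (Fin.succ_ne_zero i).symm
  · funext j; simp

/-- The zero row and the zero column have all entries `[k+1]`. Subtracting the zero row from the
others clears the column and uses `izEntry t k z - [k+1] = z * izEntry t (k + 1) z`. The factors `x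
i * y j` thus released cancel against the new Vandermonde factors, whose two signs `(-1) ^ n` also
cancel. -/
theorem izRatio_cons_zero (t : L) (k : ℕ) {n : ℕ} (x y : Fin n → L) (hx : ∀ i, x i ≠ 0)
    (hy : ∀ i, y i ≠ 0) (h1 : ∀ i j, 1 - x i * y j ≠ 0) (h2 : ∀ i j, 1 - t * (x i * y j) ≠ 0) :
    izRatio t k (Fin.cons 0 x : Fin (n + 1) → L) (Fin.cons 0 y : Fin (n + 1) → L) =
      qNat t (k + 1) * izRatio t (k + 1) x y := by
  set M := (Matrix.of fun i j : Fin (n + 1) => izEntry t k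
    ((Fin.cons 0 x : Fin (n + 1) → L) i * (Fin.cons 0 y : Fin (n + 1) → L) j)) with hM
  have h0 : izEntry t k 0 = qNat t (k + 1) := by simp [izEntry]
  set B : Matrix (Fin (n + 1)) (Fin (n + 1)) L :=
    Matrix.of (Fin.cons (M 0) fun i j => M i.succ j - M 0 j) with hB
  have hdet : M.det = B.det := by
    refine Matrix.det_eq_of_forall_row_eq_smul_add_const (c := Fin.cons 0 fun _ => 1) 0
      (by simp) ?_
    intro i j
    refine Fin.cases ?_ (fun i => ?_) i
    · simp [hB]
    · simp [hB]
  have hB0 : B.det = qNat t (k + 1) *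
      (Matrix.of fun i j : Fin n => (x i * y j) * izEntry t (k + 1) (x i * y j)).det := by
    rw [Matrix.det_succ_column_zero, Fin.sum_univ_succ, Finset.sum_eq_zero, add_zero]
    · have : (B.submatrix (Fin.succAbove 0) Fin.succ) =
          Matrix.of fun i j : Fin n => (x i * y j) * izEntry t (k + 1) (x i * y j) := by
        ext i j
        simp only [hB, hM, Matrix.submatrix_apply, Matrix.of_apply, Fin.zero_succAbove,
          Fin.cons_succ, Fin.cons_zero, zero_mul, h0]
        have a1 := h1 i j
        have a2 := h2 i j
        simp only [izEntry]
        generalize x i * y j = z at *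
        have a3 := mul_ne_zero a1 a2
        obtain ⟨d, hd⟩ : ∃ d, d = (1 - z) * (1 - t * z) := ⟨_, rfl⟩
        rw [← hd] at a3 ⊢
        field_simp
        rw [hd, qNat_succ t (k + 1), qNat_succ t k]
        ring
      rw [this]
      simp [hB, hM, h0]
    · intro i _
      simp [hB, hM]
  have hfac : (Matrix.of fun i j : Fin n => (x i * y j) * izEntry t (k + 1) (x i * y j)).det =
      (∏ i, x i) * (∏ i, y i) *
        (Matrix.of fun i j : Fin n => izEntry t (k + 1) (x i * y j)).det := by
    rw [mul_assoc, ← Matrix.det_mul_row, ← Matrix.det_mul_column]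
    congr 1
    ext i j
    simp [mul_assoc]
  have hxp : ∏ i, x i ≠ 0 := Finset.prod_ne_zero_iff.2 fun i _ => hx i
  have hyp : ∏ i, y i ≠ 0 := Finset.prod_ne_zero_iff.2 fun i _ => hy i
  have hs : ((-1 : L) ^ n) * (-1) ^ n = 1 := by
    rw [← mul_pow]; simp
  have hinv : ((-1 : L) ^ n)⁻¹ = (-1) ^ n :=
    inv_eq_of_mul_eq_one_right hs
  unfold izRatio
  rw [← hM, hdet, hB0, hfac, vdm_cons, vdm_cons]
  simp only [Fin.prod_univ_succ, Fin.cons_zero, Fin.cons_succ, mul_zero, zero_mul, sub_zero,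
    Finset.prod_const_one, one_mul, zero_sub, Finset.prod_neg, Finset.card_univ, Fintype.card_fin,
    div_eq_mul_inv, mul_inv, hinv]
  generalize (Matrix.of fun i j : Fin n => izEntry t (k + 1) (x i * y j)).det = D
  have e1 := mul_inv_cancel₀ hxp
  have e2 := mul_inv_cancel₀ hyp
  generalize (∏ i, x i)⁻¹ = a at *
  generalize (∏ i, y i)⁻¹ = b at *
  generalize (∏ i, x i) = a' at *
  generalize (∏ i, y i) = b' at *
  calc _ = (((-1 : L) ^ n) * (-1) ^ n) * (a' * a) * (b' * b) * ((∏ i, ∏ j, (1 - t * x i * y j)) *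
      (vdm x)⁻¹ * (vdm y)⁻¹ * qNat t (k + 1) * D) := by ring
    _ = _ := by rw [hs, e1, e2]; ring

end Laplace

/-! ### The closed form as a function of two finite sets -/

/-- `izRatio` for two finite sets of the same cardinality, and `0` otherwise. -/
noncomputable def izFin {L : Type*} [Field L] (t : L) (k : ℕ) (X Y : Finset L) : L :=
  if h : Y.card = X.card then
    izRatio t k (fun i => (X.equivFin.symm i : L)) fun i => (Y.equivFin.symm (Fin.cast h.symm i) : L)
  else 0

/-- The minor at `b` in the Laplace expansion of `izFin` along a new row. -/
noncomputable def izMinor {L : Type*} [Field L] [DecidableEq L] (t : L) (k : ℕ) (X Y : Finset L)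
    (b : L) : L :=
  (∏ p ∈ X, (1 - t * p * b)) / (∏ q ∈ Y.erase b, (b - q)) * izFin t k X (Y.erase b)

section Enumeration

variable {L : Type*} [DecidableEq L]

theorem exists_enum (X : Finset L) {n : ℕ} (h : X.card = n) :
    ∃ x : Fin n → L, Function.Injective x ∧ Finset.univ.image x = X := by
  refine ⟨fun i => ((X.equivFinOfCardEq h).symm i : L),
    Subtype.val_injective.comp (Equiv.injective _), ?_⟩
  ext a
  simp only [Finset.mem_image, Finset.mem_univ, true_and]
  constructor
  · rintro ⟨i, rfl⟩
    exact Subtype.property _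
  · intro ha
    exact ⟨X.equivFinOfCardEq h ⟨a, ha⟩, by simp⟩

theorem exists_perm_of_image_eq {n : ℕ} {x x' : Fin n → L}
    (hx : Function.Injective x) (h : Finset.univ.image x = Finset.univ.image x') :
    ∃ σ : Equiv.Perm (Fin n), x = x' ∘ σ := by
  have h1 : ∀ i, ∃ j, x' j = x i := fun i => by
    have : x i ∈ Finset.univ.image x' := h ▸ Finset.mem_image_of_mem x (Finset.mem_univ i)
    simpa using this
  choose f hf using h1
  have hfi : Function.Injective f := fun i j hij => hx (by rw [← hf, ← hf, hij])
  exact ⟨Equiv.ofBijective f (Finite.injective_iff_bijective.1 hfi), funext fun i => (hf i).symm⟩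

theorem image_cons {n : ℕ} (z : L) (x : Fin n → L) :
    Finset.univ.image (Fin.cons z x : Fin (n + 1) → L) = insert z (Finset.univ.image x) := by
  ext a
  simp [Fin.exists_fin_succ, eq_comm]

theorem cons_injective_of_notMem {n : ℕ} {z : L} {x : Fin n → L} (hx : Function.Injective x)
    (hz : z ∉ Finset.univ.image x) : Function.Injective (Fin.cons z x : Fin (n + 1) → L) := by
  rw [Fin.cons_injective_iff]
  exact ⟨by simpa using hz, hx⟩

theorem image_comp_succAbove {n : ℕ} {y : Fin (n + 1) → L} (hy : Function.Injective y)
    (j : Fin (n + 1)) :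
    Finset.univ.image (y ∘ j.succAbove) = (Finset.univ.image y).erase (y j) := by
  ext a
  simp only [Finset.mem_image, Finset.mem_univ, true_and, Finset.mem_erase, Function.comp_apply]
  constructor
  · rintro ⟨l, rfl⟩
    exact ⟨fun h => Fin.succAbove_ne j l (hy h), _, rfl⟩
  · rintro ⟨h, i, rfl⟩
    obtain ⟨l, rfl⟩ := Fin.exists_succAbove_eq (fun h' : i = j => h (by rw [h']))
    exact ⟨l, rfl⟩

end Enumeration

section IzFin

variable {L : Type*} [Field L]

theorem izFin_image [DecidableEq L] (t : L) (k : ℕ) {n : ℕ} {x y : Fin n → L}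
    (hx : Function.Injective x) (hy : Function.Injective y) :
    izFin t k (Finset.univ.image x) (Finset.univ.image y) = izRatio t k x y := by
  obtain ⟨X, hX⟩ : ∃ X, X = Finset.univ.image x := ⟨_, rfl⟩
  obtain ⟨Y, hY⟩ : ∃ Y, Y = Finset.univ.image y := ⟨_, rfl⟩
  have hn : n = X.card := by
    rw [hX, Finset.card_image_of_injective _ hx, Finset.card_univ, Fintype.card_fin]
  have hm : Y.card = n := by
    rw [hY, Finset.card_image_of_injective _ hy, Finset.card_univ, Fintype.card_fin]
  rw [← hX, ← hY]
  subst hn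
  have key : ∀ (Z : Finset L) (h : Z.card = X.card),
      Finset.univ.image (fun i => (Z.equivFin.symm (Fin.cast h.symm i) : L)) = Z := by
    intro Z h
    ext a
    simp only [Finset.mem_image, Finset.mem_univ, true_and]
    constructor
    · rintro ⟨i, rfl⟩
      exact Subtype.property _
    · intro ha
      exact ⟨Fin.cast h (Z.equivFin ⟨a, ha⟩), by simp⟩
  rw [izFin, dif_pos hm]
  obtain ⟨σ, hσ⟩ := exists_perm_of_image_eq hx (hX.symm.trans (key X rfl).symm)
  obtain ⟨τ, hτ⟩ := exists_perm_of_image_eq hy (hY.symm.trans (key Y hm).symm)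
  conv_rhs => rw [hσ, hτ]
  rw [izRatio_comp_left, izRatio_comp_right]
  rfl

theorem izFin_eq_zero (t : L) (k : ℕ) {X Y : Finset L} (h : Y.card ≠ X.card) :
    izFin t k X Y = 0 := dif_neg h

theorem izFin_empty (t : L) (k : ℕ) : izFin t k (∅ : Finset L) ∅ = 1 := by
  classical
  have h := izFin_image t k (x := (Fin.elim0 : Fin 0 → L)) (y := (Fin.elim0 : Fin 0 → L))
    (fun i => Fin.elim0 i) (fun i => Fin.elim0 i)
  simpa [izRatio, vdm] using h

theorem izFin_swap (t : L) (k : ℕ) (X Y : Finset L) : izFin t k X Y = izFin t k Y X := by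
  classical
  by_cases h : Y.card = X.card
  · obtain ⟨m, hm⟩ : ∃ m, X.card = m := ⟨_, rfl⟩
    rw [hm] at h
    obtain ⟨x, hx, rfl⟩ := exists_enum X hm
    obtain ⟨y, hy, hY⟩ := exists_enum Y h
    rw [← hY, izFin_image t k hx hy, izFin_image t k hy hx, izRatio_swap]
  · rw [izFin_eq_zero t k h, izFin_eq_zero t k (Ne.symm h)]

variable [DecidableEq L]

theorem sum_izMinor_image (t : L) (k : ℕ) {n : ℕ} {x : Fin n → L} {y : Fin (n + 1) → L}
    (hx : Function.Injective x) (hy : Function.Injective y) (g : L → L) :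
    ∑ b ∈ Finset.univ.image y, g b * izMinor t k (Finset.univ.image x) (Finset.univ.image y) b =
    ∑ j, g (y j) * ((∏ i, (1 - t * x i * y j)) / (∏ l, (y j - y (j.succAbove l))) *
        izRatio t k x (y ∘ j.succAbove)) := by
  rw [Finset.sum_image fun _ _ _ _ h => hy h]
  refine Finset.sum_congr rfl fun j _ => ?_
  have hyj : Function.Injective (y ∘ j.succAbove) := hy.comp Fin.succAbove_right_injective
  rw [izMinor, ← image_comp_succAbove hy j, izFin_image t k hx hyj,
    Finset.prod_image fun _ _ _ _ h => hx h, Finset.prod_image fun _ _ _ _ h => hyj h]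
  rfl

theorem izFin_insert (t : L) (k : ℕ) {X Y : Finset L} (h : Y.card = X.card + 1) {z : L}
    (hz : z ∉ X) :
    izFin t k (insert z X) Y = (∏ q ∈ Y, (1 - t * z * q)) / (∏ p ∈ X, (z - p)) *
      ∑ b ∈ Y, izEntry t k (z * b) * izMinor t k X Y b := by
  obtain ⟨m, hm⟩ : ∃ m, X.card = m := ⟨_, rfl⟩
  rw [hm] at h
  obtain ⟨x, hx, rfl⟩ := exists_enum X hm
  obtain ⟨y, hy, rfl⟩ := exists_enum Y h
  rw [sum_izMinor_image t k hx hy, ← image_cons,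
    izFin_image t k (cons_injective_of_notMem hx hz) hy, izRatio_cons,
    Finset.prod_image fun _ _ _ _ h => hx h, Finset.prod_image fun _ _ _ _ h => hy h]

theorem sum_izEntry_izMinor_eq_zero (t : L) (k : ℕ) {X Y : Finset L} (h : Y.card = X.card + 1)
    {z : L} (hz : z ∈ X) : ∑ b ∈ Y, izEntry t k (z * b) * izMinor t k X Y b = 0 := by
  obtain ⟨m, hm⟩ : ∃ m, X.card = m := ⟨_, rfl⟩
  rw [hm] at h
  obtain ⟨x, hx, rfl⟩ := exists_enum X hm
  obtain ⟨y, hy, rfl⟩ := exists_enum Y h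
  obtain ⟨i, rfl⟩ : ∃ i, x i = z := by simpa using hz
  rw [sum_izMinor_image t k hx hy fun b => izEntry t k (x i * b), sum_izEntry_eq_zero]

theorem izFin_insert_zero (t : L) (k : ℕ) {X Y : Finset L} (h : Y.card = X.card) (hX : 0 ∉ X)
    (hY : 0 ∉ Y) (h1 : ∀ p ∈ X, ∀ b ∈ Y, 1 - p * b ≠ 0)
    (h2 : ∀ p ∈ X, ∀ b ∈ Y, 1 - t * (p * b) ≠ 0) :
    izFin t k (insert 0 X) (insert 0 Y) = qNat t (k + 1) * izFin t (k + 1) X Y := by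
  obtain ⟨m, hm⟩ : ∃ m, X.card = m := ⟨_, rfl⟩
  rw [hm] at h
  obtain ⟨x, hx, rfl⟩ := exists_enum X hm
  obtain ⟨y, hy, rfl⟩ := exists_enum Y h
  rw [← image_cons, ← image_cons, izFin_image _ _ (cons_injective_of_notMem hx hX)
    (cons_injective_of_notMem hy hY), izFin_image _ _ hx hy, izRatio_cons_zero]
  · exact fun i h0 => hX (h0 ▸ Finset.mem_image_of_mem x (Finset.mem_univ i))
  · exact fun i h0 => hY (h0 ▸ Finset.mem_image_of_mem y (Finset.mem_univ i))
  · exact fun i j => h1 _ (Finset.mem_image_of_mem x (Finset.mem_univ i)) _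
      (Finset.mem_image_of_mem y (Finset.mem_univ j))
  · exact fun i j => h2 _ (Finset.mem_image_of_mem x (Finset.mem_univ i)) _
      (Finset.mem_image_of_mem y (Finset.mem_univ j))

end IzFin

/-! ### Poles and residues of the closed form in one variable -/

/-- The inverses of the nonzero elements of `Y`. -/
def nonzeroInvs {L : Type*} [Field L] [DecidableEq L] (Y : Finset L) : Finset L :=
  (Y.erase 0).image fun b => b⁻¹

/-- `∏_{p ∈ P} (1 - t p b) / (1 - p b) * ∏_{q ∈ Q} (b - t q) / (b - q)`. -/
def residueFactor {L : Type*} [Field L] (t b : L) (P Q : Finset L) : L :=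
  (∏ p ∈ P, (1 - t * p * b) / (1 - p * b)) * ∏ q ∈ Q, (b - t * q) / (b - q)

section Poles

theorem sub_inv_eq_div {L : Type*} [Field L] {z b : L} (hb : b ≠ 0) : z - b⁻¹ = -(1 - z * b) / b := by
  field_simp
  ring

variable {L : Type*} [Field L] [DecidableEq L]

theorem mem_nonzeroInvs {Y : Finset L} {s : L} : s ∈ nonzeroInvs Y ↔ s ≠ 0 ∧ s⁻¹ ∈ Y := by
  simp only [nonzeroInvs, Finset.mem_image, Finset.mem_erase]
  constructor
  · rintro ⟨b, ⟨hb, hbY⟩, rfl⟩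
    exact ⟨inv_ne_zero hb, by rwa [inv_inv]⟩
  · rintro ⟨hs, hsY⟩
    exact ⟨s⁻¹, ⟨inv_ne_zero hs, hsY⟩, inv_inv s⟩

theorem nonzeroInvs_mono {Y Y' : Finset L} (h : Y ⊆ Y') : nonzeroInvs Y ⊆ nonzeroInvs Y' :=
  fun s hs => by
    rw [mem_nonzeroInvs] at hs ⊢
    exact ⟨hs.1, h hs.2⟩

theorem notMem_nonzeroInvs {Y : Finset L} {p : L} (h : ∀ b ∈ Y, 1 - p * b ≠ 0) :
    p ∉ nonzeroInvs Y := fun hp => by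
  rw [mem_nonzeroInvs] at hp
  exact h _ hp.2 (by rw [mul_inv_cancel₀ hp.1, sub_self])

theorem nonzeroInvs_singleton {b : L} (hb : b ≠ 0) : nonzeroInvs {b} = {b⁻¹} := by
  ext s
  rw [mem_nonzeroInvs, Finset.mem_singleton, Finset.mem_singleton]
  exact ⟨fun h => by rw [← h.2, inv_inv], fun h => by rw [h, inv_inv]; exact ⟨inv_ne_zero hb, rfl⟩⟩

/-- A single term also has poles on `X`; by `h0` their residues cancel in the sum over `b`. Both
products have `X.card` factors, so each quotient stays bounded at infinity. One function `r` serves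
all `g b`, because different `b` have different poles. -/
theorem hasSimplePoles_sum_izMinor (t : L) (k : ℕ) {X Y : Finset L} (h : Y.card = X.card + 1)
    (h1 : ∀ p ∈ X, ∀ b ∈ Y, 1 - p * b ≠ 0) {g : L → L → L} {r : L → L}
    (hg : ∀ b ∈ Y, HasSimplePoles Set.univ (nonzeroInvs {b}) (g b) r)
    (h0 : ∀ p ∈ X, ∑ b ∈ Y, g b p * (∏ q ∈ Y.erase b, (1 - t * p * q)) * izMinor t k X Y b = 0) :
    HasSimplePoles {z | z ∉ X} (nonzeroInvs Y)
      (fun z => ∑ b ∈ Y, izMinor t k X Y b *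
        (g b z * ((∏ q ∈ Y.erase b, (1 - t * z * q)) / ∏ p ∈ X, (z - p))))
      (fun s => izMinor t k X Y s⁻¹ *
        (r s * ((∏ q ∈ Y.erase s⁻¹, (1 - t * s * q)) / ∏ p ∈ X, (s - p)))) := by
  have hdisj : Disjoint (nonzeroInvs Y) X := Finset.disjoint_right.2 fun p hp =>
    notMem_nonzeroInvs (h1 p hp)
  have hb : ∀ b ∈ Y, HasSimplePoles Set.univ (nonzeroInvs Y ∪ X)
      (fun z => izMinor t k X Y b *
        (g b z * ((∏ q ∈ Y.erase b, (1 - t * z * q)) / ∏ p ∈ X, (z - p))))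
      (fun s => izMinor t k X Y b * (if s ∈ nonzeroInvs {b} then
        r s * ((∏ q ∈ Y.erase b, (1 - t * s * q)) / ∏ p ∈ X, (s - p))
        else if s ∈ X then ((∏ q ∈ Y.erase b, (1 - t * s * q)) / ∏ p ∈ X.erase s, (s - p)) * g b s
        else 0)) := by
    intro b hbY
    have hsub : nonzeroInvs {b} ⊆ nonzeroInvs Y :=
      nonzeroInvs_mono (Finset.singleton_subset_iff.2 hbY)
    have e1 := HasSimplePoles.prod_div (Y.erase b) X
      (by rw [Finset.card_erase_of_mem hbY]; omega) (fun _ => 1) (fun q => -(t * q))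
    have e2 := (hg b hbY).mul e1 (Finset.disjoint_of_subset_left hsub hdisj) (by simp) (by simp)
    rw [Set.inter_self] at e2
    have hlin : ∀ z q : L, 1 + -(t * q) * z = 1 - t * z * q := fun z q => by ring
    simp only [hlin] at e2
    refine HasSimplePoles.smul _ (e2.extend (Finset.union_subset_union hsub subset_rfl) ?_ ?_)
    · intro s hs
      split_ifs with c1 c2
      · rfl
      · rfl
      · exact absurd (Finset.mem_union.1 hs) (not_or.2 ⟨c1, c2⟩)
    · intro s _ hs
      rw [Finset.mem_union, not_or] at hs
      rw [if_neg hs.1, if_neg hs.2]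
  have hsum := HasSimplePoles.sum Y hb
  refine ((hsum.mono_set (Set.subset_univ {z | z ∉ X})).shrink Finset.subset_union_left
    ?_ ?_).congr (fun _ _ _ => rfl) ?_
  · intro s hs hs'
    have hsX : s ∈ X := (Finset.mem_union.1 hs).resolve_left hs'
    rw [← mul_zero (∏ p ∈ X.erase s, (s - p))⁻¹, ← h0 s hsX, Finset.mul_sum]
    refine Finset.sum_congr rfl fun b hbY => ?_
    rw [if_neg (fun hc => hs' (nonzeroInvs_mono (Finset.singleton_subset_iff.2 hbY) hc)),
      if_pos hsX]
    ring
  · intro z hz hz'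
    exact (Finset.mem_union.1 hz').resolve_right hz
  · intro s hs
    have hs2 := mem_nonzeroInvs.1 hs
    have hsX : s ∉ X := Finset.disjoint_left.1 hdisj hs
    rw [Finset.sum_eq_single_of_mem s⁻¹ hs2.2]
    · rw [if_pos (mem_nonzeroInvs.2 ⟨hs2.1, Finset.mem_singleton_self _⟩)]
    · intro b _ hbs
      rw [if_neg, if_neg hsX, mul_zero]
      intro hc
      exact hbs (Finset.mem_singleton.1 (mem_nonzeroInvs.1 hc).2).symm

/-- Taking `s` out of each of the `X.card` factors above and below turns the residue into a product
over the separate elements of `X` and `Y`, which can later be split along subsets. -/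
theorem residue_izMinor (t : L) (k : ℕ) {X Y : Finset L} (h : Y.card = X.card + 1) {s : L}
    (hs : s ∈ nonzeroInvs Y) :
    izMinor t k X Y s⁻¹ * ((∏ q ∈ Y.erase s⁻¹, (1 - t * s * q)) / ∏ p ∈ X, (s - p)) =
      residueFactor t s⁻¹ X (Y.erase s⁻¹) * izFin t k X (Y.erase s⁻¹) := by
  obtain ⟨hs0, hsY⟩ := mem_nonzeroInvs.1 hs
  have hc : (Y.erase s⁻¹).card = X.card := by rw [Finset.card_erase_of_mem hsY]; omega
  have e1 : ∏ q ∈ Y.erase s⁻¹, (1 - t * s * q) =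
      s ^ X.card * ∏ q ∈ Y.erase s⁻¹, (s⁻¹ - t * q) := by
    rw [← hc, ← Finset.prod_const, ← Finset.prod_mul_distrib]
    exact Finset.prod_congr rfl fun q _ => by field_simp
  have e2 : ∏ p ∈ X, (s - p) = s ^ X.card * ∏ p ∈ X, (1 - p * s⁻¹) := by
    rw [← Finset.prod_const, ← Finset.prod_mul_distrib]
    exact Finset.prod_congr rfl fun q _ => by field_simp
  rw [e1, e2, izMinor, residueFactor, mul_div_mul_left _ _ (pow_ne_zero _ hs0),
    Finset.prod_div_distrib, Finset.prod_div_distrib]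
  simp only [div_eq_mul_inv]
  ring

/-- The prefactor `∏ (1 - t z q)` cancels the factor `1 - t z b` of every entry, so only the
inverses of `Y` remain as poles. The zeros of `1 - t z b` are still excluded from the domain,
because division by zero spoils the value of `izFin` there. The uses are `c = 1` and `c z = z`. -/
theorem hasSimplePoles_mul_izFin (t : L) (k : ℕ) {X Y : Finset L} (h : Y.card = X.card + 1)
    (h1 : ∀ p ∈ X, ∀ b ∈ Y, 1 - p * b ≠ 0) (h2 : ∀ p ∈ X, ∀ b ∈ Y, 1 - t * (p * b) ≠ 0)
    {c : L → L}
    (hc : ∀ b ∈ Y, HasSimplePoles Set.univ (nonzeroInvs {b})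
      (fun z => c z * ((qNat t (k + 1) - t * qNat t k * (z * b)) / (1 - z * b)))
      (fun s => -s * c s)) :
    HasSimplePoles {z | z ∉ X ∧ ∀ b ∈ Y, 1 - t * (z * b) ≠ 0} (nonzeroInvs Y)
      (fun z => c z * izFin t k (insert z X) Y)
      (fun s => -s * c s *
        (residueFactor t s⁻¹ X (Y.erase s⁻¹) * izFin t k X (Y.erase s⁻¹))) := by
  have key : ∀ z, (∀ b ∈ Y, 1 - t * (z * b) ≠ 0) → ∀ b ∈ Y,
      c z * ((qNat t (k + 1) - t * qNat t k * (z * b)) / (1 - z * b)) *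
        (∏ q ∈ Y.erase b, (1 - t * z * q)) =
      c z * (∏ q ∈ Y, (1 - t * z * q)) * izEntry t k (z * b) := by
    intro z hz b hb
    have h3 := hz b hb
    rw [← Finset.mul_prod_erase Y _ hb, izEntry, ← mul_assoc t z b, ← div_div]
    rw [← mul_assoc] at h3
    field_simp
  refine ((hasSimplePoles_sum_izMinor t k h h1 hc ?_).mono_set ?_).congr ?_ ?_
  · intro p hp
    rw [← mul_zero (c p * (∏ q ∈ Y, (1 - t * p * q))),
      ← sum_izEntry_izMinor_eq_zero t k h hp, Finset.mul_sum]
    refine Finset.sum_congr rfl fun b hb => ?_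
    rw [key p (h2 p hp) b hb, mul_assoc]
  · exact fun z hz => hz.1
  · intro z hz _
    rw [izFin_insert t k h hz.1, Finset.mul_sum, Finset.mul_sum]
    refine Finset.sum_congr rfl fun b hb => ?_
    have := key z hz.2 b hb
    simp only [div_eq_mul_inv] at this ⊢
    linear_combination -(∏ p ∈ X, (z - p))⁻¹ * izMinor t k X Y b * this
  · intro s hs
    rw [← residue_izMinor t k h hs]
    ring

/-- At `z b = 1` the numerator of the entry is `[k+1] - t [k] = 1`, so the scalar in the residue
does not depend on `k`. -/
theorem hasSimplePoles_izFin (t : L) (k : ℕ) {X Y : Finset L} (h : Y.card = X.card + 1)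
    (h1 : ∀ p ∈ X, ∀ b ∈ Y, 1 - p * b ≠ 0) (h2 : ∀ p ∈ X, ∀ b ∈ Y, 1 - t * (p * b) ≠ 0) :
    HasSimplePoles {z | z ∉ X ∧ ∀ b ∈ Y, 1 - t * (z * b) ≠ 0} (nonzeroInvs Y)
      (fun z => izFin t k (insert z X) Y)
      (fun s => -s * (residueFactor t s⁻¹ X (Y.erase s⁻¹) * izFin t k X (Y.erase s⁻¹))) := by
  refine (hasSimplePoles_mul_izFin t k (c := fun _ => 1) h h1 h2 fun b _ => ?_).congr
    (fun z _ _ => by rw [one_mul]) (fun s _ => by rw [mul_one])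
  by_cases hb : b = 0
  · subst hb
    refine ⟨qNat t (k + 1), fun z _ _ => ?_⟩
    rw [Finset.sum_eq_zero]
    · simp
    · intro s hs
      rw [mem_nonzeroInvs, Finset.mem_singleton] at hs
      exact absurd hs.2 (inv_ne_zero hs.1)
  -- The constant is the value at infinity of `([k+1] - t [k] z b) / (1 - z b)`.
  · refine ⟨t * qNat t k, fun z _ hz => ?_⟩
    rw [nonzeroInvs_singleton hb, Finset.mem_singleton] at hz
    rw [nonzeroInvs_singleton hb, Finset.sum_singleton, qNat_succ]
    have h3 : 1 - z * b ≠ 0 := fun h => hz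
      (eq_inv_of_mul_eq_one_left (sub_eq_zero.1 h).symm)
    rw [sub_inv_eq_div hb]
    field_simp
    ring

/-- For `k = 0` the numerator of the entry is `1`, and `z / (1 - z b)` is bounded at infinity with
value `-b⁻¹` if `b ≠ 0`. For larger `k`, or for `b = 0`, the extra factor `z` may produce a linear
term. -/
theorem hasSimplePoles_id_mul_izFin (t : L) {X Y : Finset L} (h : Y.card = X.card + 1)
    (h1 : ∀ p ∈ X, ∀ b ∈ Y, 1 - p * b ≠ 0) (h2 : ∀ p ∈ X, ∀ b ∈ Y, 1 - t * (p * b) ≠ 0)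
    (h0 : 0 ∉ Y) :
    HasSimplePoles {z | z ∉ X ∧ ∀ b ∈ Y, 1 - t * (z * b) ≠ 0} (nonzeroInvs Y)
      (fun z => z * izFin t 0 (insert z X) Y)
      (fun s => -s * s * (residueFactor t s⁻¹ X (Y.erase s⁻¹) * izFin t 0 X (Y.erase s⁻¹))) := by
  refine hasSimplePoles_mul_izFin t 0 (c := fun z => z) h h1 h2 fun b hbY => ?_
  have hb : b ≠ 0 := fun hb => h0 (hb ▸ hbY)
  refine ⟨-b⁻¹, fun z _ hz => ?_⟩
  rw [nonzeroInvs_singleton hb, Finset.mem_singleton] at hz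
  rw [nonzeroInvs_singleton hb, Finset.sum_singleton]
  have h3 : 1 - z * b ≠ 0 := fun h => hz
      (eq_inv_of_mul_eq_one_left (sub_eq_zero.1 h).symm)
  rw [sub_inv_eq_div hb]
  simp only [qNat, Finset.range_zero, Finset.sum_empty, zero_add, Finset.sum_range_one, pow_zero,
    mul_zero, zero_mul, sub_zero]
  field_simp
  ring

end Poles

/-! ### The recurrence operator on functions of two sets -/

/-- `∏_{i ∈ I, j ∈ X \ I} (i - t j) / (i - j)`. -/
def splitCoeff {L : Type*} [Field L] [DecidableEq L] (t : L) (I X : Finset L) : L :=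
  ∏ i ∈ I, ∏ j ∈ X \ I, (i - t * j) / (i - j)

/-- The sum over pairs of subsets of `X` and `Y` that describes how the Hall–Littlewood sum for
`X`, `Y` is built from its values `G I J` on subsets. -/
def hlSum {L : Type*} [Field L] [DecidableEq L] (t : L) (w : ℕ → L) (G : Finset L → Finset L → L)
    (X Y : Finset L) : L :=
  ∑ I ∈ X.powerset, ∑ J ∈ Y.powerset, w (X \ I).card *
    (splitCoeff t I X * splitCoeff t J Y) * ((∏ i ∈ I, i) * ∏ j ∈ J, j) * G I J

section HlSum

variable {L : Type*} [Field L] [DecidableEq L]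

theorem splitCoeff_insert_right (t : L) {I X : Finset L} {z : L} (hI : I ⊆ X) (hz : z ∉ X) :
    splitCoeff t I (insert z X) = splitCoeff t I X * ∏ i ∈ I, (i - t * z) / (i - z) := by
  have h : insert z X \ I = insert z (X \ I) :=
    Finset.insert_sdiff_of_notMem _ fun h => hz (hI h)
  rw [splitCoeff, h, splitCoeff, ← Finset.prod_mul_distrib]
  refine Finset.prod_congr rfl fun i _ => ?_
  rw [Finset.prod_insert (fun h => hz (Finset.mem_sdiff.1 h).1), mul_comm]

theorem splitCoeff_insert_insert (t : L) {I X : Finset L} {z : L} (hI : I ⊆ X) (hz : z ∉ X) :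
    splitCoeff t (insert z I) (insert z X) =
      splitCoeff t I X * ∏ j ∈ X \ I, (z - t * j) / (z - j) := by
  have h : insert z X \ insert z I = X \ I := by
    rw [Finset.insert_sdiff_insert, Finset.sdiff_insert, Finset.erase_eq_of_notMem]
    exact fun h => hz (Finset.mem_sdiff.1 h).1
  rw [splitCoeff, h, splitCoeff, Finset.prod_insert (fun h => hz (hI h)), mul_comm]

/-- The weight sees only `X \ I`, but only pairs with `I.card = J.card` contribute, and for these `X
\ I` and `Y \ J` have the same size. -/
theorem hlSum_swap (t : L) (w : ℕ → L) {G : Finset L → Finset L → L}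
    (hG : ∀ I J, G I J = G J I) (hG0 : ∀ I J, J.card ≠ I.card → G I J = 0) {X Y : Finset L}
    (h : Y.card = X.card) : hlSum t w G X Y = hlSum t w G Y X := by
  unfold hlSum
  rw [Finset.sum_comm]
  refine Finset.sum_congr rfl fun J hJ => Finset.sum_congr rfl fun I hI => ?_
  rw [hG I J]
  by_cases hc : I.card = J.card
  · rw [Finset.card_sdiff_of_subset (Finset.mem_powerset.1 hI),
      Finset.card_sdiff_of_subset (Finset.mem_powerset.1 hJ), hc, h]
    ring
  · rw [hG0 J I hc, mul_zero, mul_zero]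

/-- Subsets that contain `0` are killed by the product of their elements. For the others the new
factors are `i / i = 1`, while the complement grows by one element; hence the shift of `w`. -/
theorem hlSum_insert_zero (t : L) (w : ℕ → L) (G : Finset L → Finset L → L) {X Y : Finset L}
    (hX : 0 ∉ X) (hY : 0 ∉ Y) :
    hlSum t w G (insert 0 X) (insert 0 Y) = hlSum t (fun m => w (m + 1)) G X Y := by
  have key : ∀ {I X : Finset L}, I ⊆ X → 0 ∉ X → splitCoeff t I (insert 0 X) = splitCoeff t I X := by
    intro I X hI hX
    rw [splitCoeff_insert_right t hI hX, Finset.prod_eq_one, mul_one]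
    intro i hi
    rw [mul_zero, sub_zero, div_self]
    exact fun h => hX (hI (h ▸ hi))
  unfold hlSum
  rw [Finset.sum_powerset_insert hX]
  conv_rhs => rw [← add_zero (Finset.sum _ _)]
  congr 1
  · refine Finset.sum_congr rfl fun I hI => ?_
    rw [Finset.mem_powerset] at hI
    rw [Finset.sum_powerset_insert hY]
    conv_rhs => rw [← add_zero (Finset.sum _ _)]
    congr 1
    · refine Finset.sum_congr rfl fun J hJ => ?_
      rw [Finset.mem_powerset] at hJ
      rw [Finset.insert_sdiff_of_notMem _ (fun h => hX (hI h)),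
        Finset.card_insert_of_notMem (fun h => hX (Finset.mem_sdiff.1 h).1), key hI hX, key hJ hY]
    · refine Finset.sum_eq_zero fun J hJ => ?_
      rw [Finset.prod_insert (fun h => hY (Finset.mem_powerset.1 hJ h))]
      ring
  · refine Finset.sum_eq_zero fun I hI => Finset.sum_eq_zero fun J _ => ?_
    rw [Finset.prod_insert (fun h => hX (Finset.mem_powerset.1 hI h))]
    ring

/-- The contribution to `hlSum` of the subsets that omit the new element `z`. -/
theorem hasSimplePoles_splitCoeff (t A : L) {I X : Finset L} (hI : I ⊆ X) :
    HasSimplePoles Set.univ X (fun z => A * ∏ i ∈ I, (i - t * z) / (i - z))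
      (fun s => if s ∈ I then A * ((t * s - s) * ∏ i ∈ I.erase s, (i - t * s) / (i - s)) else 0) := by
  have h := (HasSimplePoles.prod_div I I rfl (fun i => -i) (fun _ => t)).smul A
  have flip : ∀ a b : L, (-a + t * b) / (b - a) = (a - t * b) / (a - b) := fun a b => by
    rw [← neg_div_neg_eq]
    congr 1 <;> ring
  refine (h.congr (fun z _ _ => ?_) fun s hs => ?_).extend hI (fun s hs => rfl)
    (fun s _ hs => if_neg hs)
  · rw [← Finset.prod_div_distrib]
    simp only [flip]
  · rw [if_pos hs, ← Finset.mul_prod_erase I _ hs, mul_div_assoc, ← Finset.prod_div_distrib]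
    simp only [flip]
    ring

/-- The contribution to `hlSum` of the subsets that contain the new element `z`. -/
theorem hasSimplePoles_splitCoeff_insert (t A : L) {I X J Y : Finset L} (hI : I ⊆ X) (hJ : J ⊆ Y)
    (hJ0 : 0 ∉ J) (h1 : ∀ p ∈ X, ∀ b ∈ Y, 1 - p * b ≠ 0)
    (h2 : ∀ p ∈ X, ∀ b ∈ Y, 1 - t * (p * b) ≠ 0) :
    HasSimplePoles {z | z ∉ X ∧ ∀ b ∈ Y, 1 - t * (z * b) ≠ 0} (X ∪ nonzeroInvs Y)
      (fun z => A * ((∏ j ∈ X \ I, (z - t * j) / (z - j)) * (z * izFin t 0 (insert z I) J)))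
      (fun s => if s ∈ X then
          if s ∈ I then 0 else
            A * ((s - t * s) * (∏ j ∈ (X \ I).erase s, (s - t * j) / (s - j)) *
              (s * izFin t 0 (insert s I) J))
        else if s⁻¹ ∈ J then
          A * (-s * s * (residueFactor t s⁻¹ I (J.erase s⁻¹) * izFin t 0 I (J.erase s⁻¹)) *
            ∏ j ∈ X \ I, (s - t * j) / (s - j))
        else 0) := by
  by_cases hc : J.card = I.card + 1
  · have e1 := HasSimplePoles.prod_div (X \ I) (X \ I) rfl (fun j => -(t * j)) (fun _ => 1)
    have e2 := hasSimplePoles_id_mul_izFin t hc (fun p hp b hb => h1 p (hI hp) b (hJ hb))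
      (fun p hp b hb => h2 p (hI hp) b (hJ hb)) hJ0
    have hdisj : ∀ p ∈ X, p ∉ nonzeroInvs J := fun p hp =>
      notMem_nonzeroInvs fun b hb => h1 p hp b (hJ hb)
    have e3 := (e1.mul e2 (Finset.disjoint_left.2 fun p hp =>
      hdisj p (Finset.mem_sdiff.1 hp).1) (fun s hs => ⟨(Finset.mem_sdiff.1 hs).2,
        fun b hb => h2 s (Finset.mem_sdiff.1 hs).1 b (hJ hb)⟩) (by simp)).smul A
    have hlin : ∀ z j : L, -(t * j) + 1 * z = z - t * j := fun z j => by ring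
    simp only [hlin] at e3
    refine ((e3.mono_set ?_).congr (fun z _ _ => ?_) (fun s _ => rfl)).extend
      (Finset.union_subset_union Finset.sdiff_subset (nonzeroInvs_mono hJ)) ?_ ?_
    · exact fun z hz => ⟨trivial, fun hzI => hz.1 (hI hzI), fun b hb => hz.2 b (hJ hb)⟩
    · rw [Finset.prod_div_distrib]
    · intro s hs
      rcases Finset.mem_union.1 hs with hs | hs
      · have hs' := Finset.mem_sdiff.1 hs
        rw [if_pos hs'.1, if_neg hs'.2, if_pos hs, ← Finset.mul_prod_erase (X \ I) _ hs,
          mul_div_assoc, ← Finset.prod_div_distrib]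
      · have hsX : s ∉ X := fun h => hdisj s h hs
        rw [if_neg hsX, if_pos (mem_nonzeroInvs.1 hs).2,
          if_neg (fun h => hsX (Finset.mem_sdiff.1 h).1), Finset.prod_div_distrib]
    · intro s hs hs'
      rw [Finset.mem_union, not_or] at hs'
      by_cases hsX : s ∈ X
      · have hsI : s ∈ I := by
          by_contra h
          exact hs'.1 (Finset.mem_sdiff.2 ⟨hsX, h⟩)
        rw [if_pos hsX, if_pos hsI]
      · have hsY := (Finset.mem_union.1 hs).resolve_left hsX
        rw [if_neg hsX, if_neg]
        exact fun h => hs'.2 (mem_nonzeroInvs.2 ⟨(mem_nonzeroInvs.1 hsY).1, h⟩)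
  · refine (HasSimplePoles.const 0).congr (fun z hz _ => ?_) (fun s _ => ?_)
    · rw [izFin_eq_zero, mul_zero, mul_zero, mul_zero]
      rw [Finset.card_insert_of_notMem fun h => hz.1 (hI h)]
      exact hc
    · split_ifs with c1 c2 c3
      · rfl
      · rw [izFin_eq_zero, mul_zero, mul_zero, mul_zero]
        rw [Finset.card_insert_of_notMem c2]
        exact hc
      · rw [izFin_eq_zero t 0 (X := I)]
        · ring
        · rw [Finset.card_erase_of_mem c3]
          have := Finset.card_pos.2 ⟨_, c3⟩
          omega
      · rfl

end HlSum

/-! ### The closed form satisfies the recurrence -/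

section Recurrence

variable {L : Type*} [Field L] [DecidableEq L]

theorem hlSum_insert (t : L) (w : ℕ → L) (G : Finset L → Finset L → L) {X Y : Finset L} {z : L}
    (hz : z ∉ X) :
    hlSum t w G (insert z X) Y = ∑ I ∈ X.powerset, ∑ J ∈ Y.powerset,
      ((w ((X \ I).card + 1) * (splitCoeff t I X * splitCoeff t J Y) *
          ((∏ i ∈ I, i) * ∏ j ∈ J, j) * G I J) * (∏ i ∈ I, (i - t * z) / (i - z)) +
        (w (X \ I).card * (splitCoeff t I X * splitCoeff t J Y) * ((∏ i ∈ I, i) * ∏ j ∈ J, j)) *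
          ((∏ j ∈ X \ I, (z - t * j) / (z - j)) * (z * G (insert z I) J))) := by
  rw [hlSum, Finset.sum_powerset_insert hz, ← Finset.sum_add_distrib]
  refine Finset.sum_congr rfl fun I hI => ?_
  rw [Finset.mem_powerset] at hI
  rw [← Finset.sum_add_distrib]
  refine Finset.sum_congr rfl fun J _ => ?_
  rw [splitCoeff_insert_right t hI hz, splitCoeff_insert_insert t hI hz,
    Finset.insert_sdiff_of_notMem _ (fun h => hz (hI h)),
    Finset.card_insert_of_notMem (fun h => hz (Finset.mem_sdiff.1 h).1),
    Finset.prod_insert (fun h => hz (hI h)), Finset.insert_sdiff_insert, Finset.sdiff_insert,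
    Finset.erase_eq_of_notMem fun h => hz (Finset.mem_sdiff.1 h).1]
  ring

/-- Of the two extra products, the one over `X \ I` comes from adjoining `s` to `I`, the one over `Y
\ J` from adjoining `s⁻¹` to `J` in `splitCoeff`. So the residues of all terms of `hlSum` share the
factor `residueFactor t s⁻¹ X Y`. -/
theorem residueFactor_eq_mul {t s : L} (hs : s ≠ 0) {X Y I J : Finset L} (hI : I ⊆ X)
    (hJ : J ⊆ Y) :
    residueFactor t s⁻¹ X Y = residueFactor t s⁻¹ I J *
      ((∏ j ∈ X \ I, (s - t * j) / (s - j)) * ∏ l ∈ Y \ J, (s⁻¹ - t * l) / (s⁻¹ - l)) := by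
  have e : ∀ j, (s - t * j) / (s - j) = (1 - t * j * s⁻¹) / (1 - j * s⁻¹) := fun j => by
    rw [show s - t * j = s * (1 - t * j * s⁻¹) by field_simp,
      show s - j = s * (1 - j * s⁻¹) by field_simp, mul_div_mul_left _ _ hs]
  simp only [residueFactor, e]
  rw [← Finset.prod_sdiff hI, ← Finset.prod_sdiff hJ]
  ring

/-- As a function of a new element `z`, the sum `hlSum` has simple poles at the inverses of the
elements of `Y` only, and its residues are given by `hlSum` on smaller sets. -/
theorem hasSimplePoles_hlSum (t : L) (w : ℕ → L) {X Y : Finset L}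
    (h1 : ∀ p ∈ X, ∀ b ∈ Y, 1 - p * b ≠ 0) (h2 : ∀ p ∈ X, ∀ b ∈ Y, 1 - t * (p * b) ≠ 0) :
    HasSimplePoles {z | z ∉ X ∧ ∀ b ∈ Y, 1 - t * (z * b) ≠ 0} (nonzeroInvs Y)
      (fun z => hlSum t w (izFin t 0) (insert z X) Y)
      (fun s => -s * (residueFactor t s⁻¹ X (Y.erase s⁻¹) *
        hlSum t w (izFin t 0) X (Y.erase s⁻¹))) := by
  have hterm : ∀ I ∈ X.powerset, ∀ J ∈ Y.powerset,
      HasSimplePoles {z | z ∉ X ∧ ∀ b ∈ Y, 1 - t * (z * b) ≠ 0} (X ∪ nonzeroInvs Y)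
        (fun z => (w ((X \ I).card + 1) * (splitCoeff t I X * splitCoeff t J Y) *
          ((∏ i ∈ I, i) * ∏ j ∈ J, j) * izFin t 0 I J) * (∏ i ∈ I, (i - t * z) / (i - z)) +
        (w (X \ I).card * (splitCoeff t I X * splitCoeff t J Y) * ((∏ i ∈ I, i) * ∏ j ∈ J, j)) *
          ((∏ j ∈ X \ I, (z - t * j) / (z - j)) * (z * izFin t 0 (insert z I) J)))
        (fun s => (if s ∈ I then
            (w ((X \ I).card + 1) * (splitCoeff t I X * splitCoeff t J Y) *
              ((∏ i ∈ I, i) * ∏ j ∈ J, j) * izFin t 0 I J) *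
              ((t * s - s) * ∏ i ∈ I.erase s, (i - t * s) / (i - s)) else 0) +
          if s ∈ X then
            if s ∈ I then 0 else
              (w (X \ I).card * (splitCoeff t I X * splitCoeff t J Y) *
                ((∏ i ∈ I, i) * ∏ j ∈ J, j)) *
                ((s - t * s) * (∏ j ∈ (X \ I).erase s, (s - t * j) / (s - j)) *
                (s * izFin t 0 (insert s I) J))
          else if s⁻¹ ∈ J then
            (w (X \ I).card * (splitCoeff t I X * splitCoeff t J Y) *
              ((∏ i ∈ I, i) * ∏ j ∈ J, j)) *
              (-s * s * (residueFactor t s⁻¹ I (J.erase s⁻¹) * izFin t 0 I (J.erase s⁻¹)) *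
              ∏ j ∈ X \ I, (s - t * j) / (s - j))
          else 0) := by
    intro I hI J hJ
    rw [Finset.mem_powerset] at hI hJ
    refine HasSimplePoles.add ?_ ?_
    · refine ((hasSimplePoles_splitCoeff t _ hI).mono_set (Set.subset_univ _)).extend
        Finset.subset_union_left (fun s _ => rfl) (fun s _ hs => if_neg fun h => hs (hI h))
    -- If `0 ∈ J`, where the bound at infinity could fail, the product of the elements of `J` is
    -- zero.
    · by_cases hJ0 : 0 ∈ J
      · rw [Finset.prod_eq_zero hJ0 rfl]
        simpa using HasSimplePoles.const 0
      · exact hasSimplePoles_splitCoeff_insert t _ hI hJ hJ0 h1 h2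
  have hsum := HasSimplePoles.sum X.powerset fun I hI =>
    HasSimplePoles.sum Y.powerset (hterm I hI)
  refine ((hsum.congr (fun z hz _ => hlSum_insert t w _ hz.1) fun s _ => rfl).shrink
    Finset.subset_union_right ?_ ?_).congr (fun z _ _ => rfl) ?_
  · intro s hs hs'
    have hsX : s ∈ X := (Finset.mem_union.1 hs).resolve_right hs'
    -- The pole at `s ∈ X` is spurious: the terms of `I` and `insert s I` carry the same weight and
    -- have opposite residues, with factors `s - t s` and `t s - s`.
    obtain ⟨X', hsX', rfl⟩ : ∃ X', s ∉ X' ∧ X = insert s X' :=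
      ⟨X.erase s, Finset.notMem_erase s X, (Finset.insert_erase hsX).symm⟩
    rw [Finset.sum_powerset_insert hsX', ← Finset.sum_add_distrib]
    refine Finset.sum_eq_zero fun I hI => ?_
    rw [Finset.mem_powerset] at hI
    have hsI : s ∉ I := fun h => hsX' (hI h)
    rw [← Finset.sum_add_distrib]
    refine Finset.sum_eq_zero fun J _ => ?_
    have hd : s ∉ X' \ I := fun h => hsX' (Finset.mem_sdiff.1 h).1
    simp only [hsX, hsI, Finset.mem_insert_self, if_true, if_false]
    rw [splitCoeff_insert_right t hI hsX', splitCoeff_insert_insert t hI hsX',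
      Finset.insert_sdiff_of_notMem _ hsI, Finset.card_insert_of_notMem hd,
      Finset.insert_sdiff_insert, Finset.sdiff_insert, Finset.erase_eq_of_notMem hd,
      Finset.erase_insert hd, Finset.erase_insert hsI, Finset.prod_insert hsI]
    ring
  · intro z hz hz'
    exact (Finset.mem_union.1 hz').resolve_left hz.1
  · intro s hs
    obtain ⟨hs0, hsY⟩ := mem_nonzeroInvs.1 hs
    have hsX : s ∉ X := fun h => notMem_nonzeroInvs (h1 s h) hs
    -- Only the subsets of `Y` that contain `s⁻¹` have a pole at `s`; they are the sets `insert s⁻¹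
    -- J` with `J ⊆ Y'`.
    obtain ⟨Y', hsY', hY⟩ : ∃ Y', s⁻¹ ∉ Y' ∧ Y = insert s⁻¹ Y' :=
      ⟨Y.erase s⁻¹, Finset.notMem_erase _ Y, (Finset.insert_erase hsY).symm⟩
    subst hY
    rw [hlSum, Finset.erase_insert hsY', Finset.mul_sum, Finset.mul_sum]
    refine Finset.sum_congr rfl fun I hI => ?_
    rw [Finset.mem_powerset] at hI
    have hsI : s ∉ I := fun h => hsX (hI h)
    rw [Finset.sum_powerset_insert hsY', Finset.mul_sum, Finset.mul_sum,
      ← Finset.sum_add_distrib]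
    refine Finset.sum_congr rfl fun J hJ => ?_
    rw [Finset.mem_powerset] at hJ
    have hsJ : s⁻¹ ∉ J := fun h => hsY' (hJ h)
    simp only [hsX, hsI, hsJ, Finset.mem_insert_self, if_true, if_false]
    rw [splitCoeff_insert_insert t hJ hsY', Finset.erase_insert hsJ, Finset.prod_insert hsJ,
      residueFactor_eq_mul hs0 hI hJ]
    have e : s * s⁻¹ = 1 := mul_inv_cancel₀ hs0
    linear_combination (s * w (X \ I).card * (splitCoeff t I X * splitCoeff t J Y') *
      ((∏ i ∈ I, i) * ∏ j ∈ J, j) * izFin t 0 I J * residueFactor t s⁻¹ I J *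
      ((∏ j ∈ X \ I, (s - t * j) / (s - j)) * ∏ l ∈ Y' \ J, (s⁻¹ - t * l) / (s⁻¹ - l))) * e

/-- The recurrence of the determinantal closed form. -/
theorem hlSum_izFin (t : L) (k : ℕ) {X Y : Finset L} (h : Y.card = X.card)
    (h1 : ∀ p ∈ X, ∀ b ∈ Y, 1 - p * b ≠ 0) (h2 : ∀ p ∈ X, ∀ b ∈ Y, 1 - t * (p * b) ≠ 0) :
    hlSum t (fun m => qFact t (m + k)) (izFin t 0) X Y = qFact t k * izFin t k X Y := by
  obtain ⟨n, hn⟩ : ∃ n, X.card = n := ⟨_, rfl⟩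
  induction n generalizing k X Y with
  | zero =>
    rw [hn] at h
    rw [Finset.card_eq_zero] at h hn
    subst h hn
    simp [hlSum, splitCoeff, izFin_empty]
  | succ n ih =>
    -- In the variable `z` both sides have the same poles and, by induction, the same residues, so
    -- agreement at `0` gives agreement at `z`.
    have move : ∀ {X Y : Finset L}, Y.card = X.card + 1 → X.card = n →
        (∀ p ∈ X, ∀ b ∈ Y, 1 - p * b ≠ 0) → (∀ p ∈ X, ∀ b ∈ Y, 1 - t * (p * b) ≠ 0) →
        ∀ z, z ∉ X → (∀ b ∈ Y, 1 - z * b ≠ 0) → (∀ b ∈ Y, 1 - t * (z * b) ≠ 0) → 0 ∉ X →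
        hlSum t (fun m => qFact t (m + k)) (izFin t 0) (insert 0 X) Y =
          qFact t k * izFin t k (insert 0 X) Y →
        hlSum t (fun m => qFact t (m + k)) (izFin t 0) (insert z X) Y =
          qFact t k * izFin t k (insert z X) Y := by
      intro X Y h hX h1 h2 z hz hz1 hz2 h0 heq
      have e1 := hasSimplePoles_hlSum t (fun m => qFact t (m + k)) h1 h2
      have e2 := ((hasSimplePoles_izFin t k h h1 h2).smul (qFact t k)).congr
        (ρ' := fun s => -s * (residueFactor t s⁻¹ X (Y.erase s⁻¹) *
          hlSum t (fun m => qFact t (m + k)) (izFin t 0) X (Y.erase s⁻¹)))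
        (fun _ _ _ => rfl) (fun s hs => ?_)
      · have e3 := e1.sub_eq_sub e2 (z := z) (w := 0) ⟨hz, hz2⟩ (notMem_nonzeroInvs hz1)
          ⟨h0, by simp⟩ (notMem_nonzeroInvs (by simp))
        rw [heq, sub_self, sub_eq_zero] at e3
        exact e3
      · rw [ih k (X := X) (Y := Y.erase s⁻¹) (by
            rw [Finset.card_erase_of_mem (mem_nonzeroInvs.1 hs).2]; omega)
          (fun p hp b hb => h1 p hp b (Finset.mem_of_mem_erase hb))
          (fun p hp b hb => h2 p hp b (Finset.mem_of_mem_erase hb)) hX]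
        ring
    have swap : ∀ {X Y : Finset L}, Y.card = X.card →
        (hlSum t (fun m => qFact t (m + k)) (izFin t 0) X Y = qFact t k * izFin t k X Y ↔
        hlSum t (fun m => qFact t (m + k)) (izFin t 0) Y X = qFact t k * izFin t k Y X) := by
      intro X Y h
      rw [hlSum_swap t _ (izFin_swap t 0) (fun I J => izFin_eq_zero t 0) h, izFin_swap t k X Y]
    -- A zero in each set: drop both zeros and raise `k` by one.
    have base : ∀ {X Y : Finset L}, X.card = n → Y.card = n → 0 ∉ X → 0 ∉ Y →
        (∀ p ∈ X, ∀ b ∈ Y, 1 - p * b ≠ 0) → (∀ p ∈ X, ∀ b ∈ Y, 1 - t * (p * b) ≠ 0) →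
        hlSum t (fun m => qFact t (m + k)) (izFin t 0) (insert 0 X) (insert 0 Y) =
          qFact t k * izFin t k (insert 0 X) (insert 0 Y) := by
      intro X Y hX hY hX0 hY0 h1 h2
      have e := ih (k + 1) (hY.trans hX.symm) h1 h2 hX
      rw [hlSum_insert_zero t _ _ hX0 hY0, izFin_insert_zero t k (hY.trans hX.symm) hX0 hY0 h1 h2,
        ← mul_assoc, ← qFact_succ, ← e]
      congr 1
      funext m
      rw [add_assoc, add_comm 1 k]
    -- A zero in `X` only: after exchanging the two sets, an element of `Y` is moved to `0`.
    have half : ∀ {X Y : Finset L}, X.card = n → 0 ∉ X → Y.card = n + 1 →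
        (∀ p ∈ X, ∀ b ∈ Y, 1 - p * b ≠ 0) → (∀ p ∈ X, ∀ b ∈ Y, 1 - t * (p * b) ≠ 0) →
        hlSum t (fun m => qFact t (m + k)) (izFin t 0) (insert 0 X) Y =
          qFact t k * izFin t k (insert 0 X) Y := by
      intro X Y hX hX0 hY h1 h2
      have hXc : (insert 0 X).card = n + 1 := by rw [Finset.card_insert_of_notMem hX0, hX]
      by_cases hY0 : 0 ∈ Y
      · rw [← Finset.insert_erase hY0]
        exact base hX (by rw [Finset.card_erase_of_mem hY0, hY]; rfl) hX0
          (Finset.notMem_erase 0 Y) (fun p hp b hb => h1 p hp b (Finset.mem_of_mem_erase hb))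
          (fun p hp b hb => h2 p hp b (Finset.mem_of_mem_erase hb))
      · obtain ⟨z, hz⟩ : Y.Nonempty := Finset.card_pos.1 (by omega)
        have hYe : (Y.erase z).card = n := by rw [Finset.card_erase_of_mem hz, hY]; rfl
        have g1 : ∀ b ∈ Y, ∀ p ∈ insert 0 X, 1 - b * p ≠ 0 := by
          intro b hb p hp
          rcases Finset.mem_insert.1 hp with rfl | hp
          · simp
          · rw [mul_comm]; exact h1 p hp b hb
        have g2 : ∀ b ∈ Y, ∀ p ∈ insert 0 X, 1 - t * (b * p) ≠ 0 := by
          intro b hb p hp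
          rcases Finset.mem_insert.1 hp with rfl | hp
          · simp
          · rw [mul_comm b]; exact h2 p hp b hb
        rw [swap (hY.trans hXc.symm), ← Finset.insert_erase hz]
        refine move (by rw [hXc, hYe]) hYe (fun p hp => g1 p (Finset.mem_of_mem_erase hp))
          (fun p hp => g2 p (Finset.mem_of_mem_erase hp)) z (Finset.notMem_erase z Y) (g1 z hz)
          (g2 z hz) (fun h => hY0 (Finset.mem_of_mem_erase h)) ?_
        have hY0' : (0 : L) ∉ Y.erase z := fun h => hY0 (Finset.mem_of_mem_erase h)
        rw [swap (by rw [Finset.card_insert_of_notMem hY0', hYe, hXc])]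
        exact base hX hYe hX0 hY0' (fun p hp b hb => h1 p hp b (Finset.mem_of_mem_erase hb))
          (fun p hp b hb => h2 p hp b (Finset.mem_of_mem_erase hb))
    by_cases hX0 : 0 ∈ X
    · rw [← Finset.insert_erase hX0]
      exact half (by rw [Finset.card_erase_of_mem hX0, hn]; rfl) (Finset.notMem_erase 0 X)
        (h.trans hn) (fun p hp => h1 p (Finset.mem_of_mem_erase hp))
        (fun p hp => h2 p (Finset.mem_of_mem_erase hp))
    · obtain ⟨z, hz⟩ : X.Nonempty := Finset.card_pos.1 (by omega)
      have hXe : (X.erase z).card = n := by rw [Finset.card_erase_of_mem hz, hn]; rfl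
      have hX0' : (0 : L) ∉ X.erase z := fun h => hX0 (Finset.mem_of_mem_erase h)
      rw [← Finset.insert_erase hz]
      exact move (by rw [hXe, h, hn]) hXe (fun p hp => h1 p (Finset.mem_of_mem_erase hp))
        (fun p hp => h2 p (Finset.mem_of_mem_erase hp)) z (Finset.notMem_erase z X) (h1 z hz)
        (h2 z hz) hX0' (half hXe hX0' (h.trans hn)
          (fun p hp => h1 p (Finset.mem_of_mem_erase hp))
          (fun p hp => h2 p (Finset.mem_of_mem_erase hp)))

end Recurrence

/-! ### Symmetrization as a recursion on sets -/

/-- The sum over all orderings of `X` of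
`∏_i x_i ^ lam_i * ∏_{i < j} (x_i - t x_j) / (x_i - x_j)`, written as an iterated sum over the
last element in the ordering; it is `0` if `X` does not have `n` elements. -/
def hlSym {L : Type*} [Field L] [DecidableEq L] (t : L) : (n : ℕ) → (Fin n → ℕ) → Finset L → L
  | 0, _, X => if X = ∅ then 1 else 0
  | n + 1, lam, X => ∑ a ∈ X, a ^ lam (Fin.last n) *
      (∏ j ∈ X.erase a, (j - t * a) / (j - a)) * hlSym t n (lam ∘ Fin.castSucc) (X.erase a)

/-- The partition with `n` parts obtained from `r` parts by adding `1` to each of them and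
appending zeros. -/
def extendParts (n : ℕ) {r : ℕ} (mu : Fin r → ℕ) (i : Fin n) : ℕ :=
  if h : (i : ℕ) < r then mu ⟨i, h⟩ + 1 else 0

section HlSym

variable {L : Type*} [Field L] [DecidableEq L]

theorem hlSym_eq_zero (t : L) {n : ℕ} (lam : Fin n → ℕ) {X : Finset L} (h : X.card ≠ n) :
    hlSym t n lam X = 0 := by
  induction n generalizing X with
  | zero => exact if_neg fun h' => h (by simp [h'])
  | succ n ih =>
    refine Finset.sum_eq_zero fun a ha => ?_
    rw [ih, mul_zero]
    rw [Finset.card_erase_of_mem ha]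
    have := Finset.card_pos.2 ⟨a, ha⟩
    omega

theorem hlSym_add_one (t : L) {n : ℕ} (lam : Fin n → ℕ) (X : Finset L) :
    hlSym t n (fun i => lam i + 1) X = (∏ i ∈ X, i) * hlSym t n lam X := by
  induction n generalizing X with
  | zero =>
    by_cases h : X = ∅
    · simp [hlSym, h]
    · simp [hlSym, h]
  | succ n ih =>
    simp only [hlSym, Finset.mul_sum]
    refine Finset.sum_congr rfl fun a ha => ?_
    have := ih (lam ∘ Fin.castSucc) (X.erase a)
    simp only [Function.comp_def] at this ⊢
    rw [this, ← Finset.mul_prod_erase X _ ha]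
    ring

/-- As a function of one element `z` of `X`, the sum has cancelling residues and is therefore
constant. At `z = 0` the term of `z` is `1`, and the others are `t` times the sum for the smaller
set, which gives `1 + t [n] = [n+1]`. -/
theorem sum_prod_erase_div (t : L) (X : Finset L) :
    ∑ a ∈ X, ∏ j ∈ X.erase a, (j - t * a) / (j - a) = qNat t X.card := by
  obtain ⟨n, hn⟩ : ∃ n, X.card = n := ⟨_, rfl⟩
  induction n generalizing X with
  | zero =>
    rw [Finset.card_eq_zero] at hn
    simp [hn, qNat]
  | succ n ih =>
    have expand : ∀ {X : Finset L} {z : L}, z ∉ X →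
        ∑ a ∈ insert z X, ∏ j ∈ (insert z X).erase a, (j - t * a) / (j - a) =
        (∏ j ∈ X, (j - t * z) / (j - z)) +
          ∑ a ∈ X, (z - t * a) / (z - a) * ∏ j ∈ X.erase a, (j - t * a) / (j - a) := by
      intro X z hz
      rw [Finset.sum_insert hz, Finset.erase_insert hz]
      congr 1
      refine Finset.sum_congr rfl fun a ha => ?_
      have hza : z ≠ a := fun h => hz (h ▸ ha)
      rw [Finset.erase_insert_of_ne hza,
        Finset.prod_insert fun h => hz (Finset.mem_of_mem_erase h)]
    have base : ∀ {X : Finset L}, X.card = n → 0 ∉ X →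
        ∑ a ∈ insert 0 X, ∏ j ∈ (insert 0 X).erase a, (j - t * a) / (j - a) = qNat t (n + 1) := by
      intro X hX h0
      rw [expand h0, Finset.prod_eq_one, qNat_succ, ← hX, ← ih X hX, Finset.mul_sum]
      · congr 1
        refine Finset.sum_congr rfl fun a ha => ?_
        have ha0 : a ≠ 0 := fun h => h0 (h ▸ ha)
        congr 1
        field_simp
        ring
      · intro j hj
        rw [mul_zero, sub_zero, div_self fun h => h0 (h ▸ hj)]
    by_cases h0 : 0 ∈ X
    · rw [hn, ← Finset.insert_erase h0]
      exact base (by rw [Finset.card_erase_of_mem h0, hn]; rfl) (Finset.notMem_erase 0 X)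
    · obtain ⟨z, hz⟩ : X.Nonempty := Finset.card_pos.1 (by omega)
      have hXe : (X.erase z).card = n := by rw [Finset.card_erase_of_mem hz, hn]; rfl
      have h0' : (0 : L) ∉ X.erase z := fun h => h0 (Finset.mem_of_mem_erase h)
      rw [hn, ← base hXe h0', expand h0']
      conv_lhs => rw [← Finset.insert_erase hz, expand (Finset.notMem_erase z X)]
      have hzX := Finset.notMem_erase z X
      generalize X.erase z = X at *
      -- `p1` is the term of `z`, `p2` minus the sum of the other terms. Their residues are equal,
      -- so their difference, the full sum, has the same value at `z` and at `0`.
      have p1 := hasSimplePoles_splitCoeff t 1 (subset_refl X)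
      have p2 : HasSimplePoles Set.univ X
          (fun z => -∑ a ∈ X, (z - t * a) / (z - a) * ∏ j ∈ X.erase a, (j - t * a) / (j - a))
          (fun a => -((a - t * a) * ∏ j ∈ X.erase a, (j - t * a) / (j - a))) := by
        refine ⟨-∑ a ∈ X, ∏ j ∈ X.erase a, (j - t * a) / (j - a), fun z _ hz => ?_⟩
        beta_reduce
        rw [← Finset.sum_neg_distrib, ← Finset.sum_neg_distrib, ← Finset.sum_add_distrib]
        refine Finset.sum_congr rfl fun a ha => ?_
        have : z - a ≠ 0 := sub_ne_zero.2 fun h => hz (h ▸ ha)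
        field_simp
        ring
      have p3 := (p1.congr (fun _ _ _ => rfl) fun s hs => by
        rw [if_pos hs]; ring).sub_eq_sub p2 (Set.mem_univ z) hzX (Set.mem_univ 0) h0'
      simpa using p3

/-- Induction on the number of zeros. The last element `a` of the ordering has exponent `0`; after
exchanging the sums, `a` runs over `X \ I` for fixed `I`, and `sum_prod_erase_div` yields the new
factor `[k+1]`. -/
theorem hlSym_extendParts (t : L) {r : ℕ} (mu : Fin r → ℕ) (k : ℕ) {X : Finset L}
    (hX : X.card = r + k) :
    hlSym t (r + k) (extendParts (r + k) mu) X =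
      qFact t k * ∑ I ∈ X.powerset, splitCoeff t I X * (∏ i ∈ I, i) * hlSym t r mu I := by
  induction k generalizing X with
  | zero =>
    have e : extendParts (r + 0) mu = fun i => mu i + 1 := by
      funext i
      exact dif_pos i.2
    rw [e, Finset.sum_eq_single_of_mem X (Finset.mem_powerset_self X)]
    · have := hlSym_add_one t mu X
      simpa [splitCoeff, qFact] using this
    · intro I hI hIX
      rw [hlSym_eq_zero, mul_zero]
      intro h
      exact hIX (Finset.eq_of_subset_of_card_le (Finset.mem_powerset.1 hI) (by omega))
  | succ k ih =>
    have e1 : extendParts (r + (k + 1)) mu (Fin.last (r + k)) = 0 :=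
      dif_neg (by simp)
    have e2 : extendParts (r + (k + 1)) mu ∘ Fin.castSucc = extendParts (r + k) mu := rfl
    change ∑ a ∈ X, a ^ extendParts (r + (k + 1)) mu (Fin.last (r + k)) * _ *
      hlSym t (r + k) (extendParts (r + (k + 1)) mu ∘ Fin.castSucc) _ = _
    rw [e1, e2]
    have step : ∀ a ∈ X, a ^ 0 * (∏ j ∈ X.erase a, (j - t * a) / (j - a)) *
        hlSym t (r + k) (extendParts (r + k) mu) (X.erase a) =
        ∑ I ∈ (X.erase a).powerset, qFact t k * ((∏ j ∈ X.erase a, (j - t * a) / (j - a)) *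
          (splitCoeff t I (X.erase a) * (∏ i ∈ I, i) * hlSym t r mu I)) := by
      intro a ha
      rw [ih (by rw [Finset.card_erase_of_mem ha, hX]; rfl), pow_zero, one_mul, Finset.mul_sum,
        Finset.mul_sum]
      exact Finset.sum_congr rfl fun I _ => by ring
    rw [Finset.sum_congr rfl step, Finset.sum_comm' (t' := X.powerset) (s' := fun I => X \ I),
      Finset.mul_sum]
    · refine Finset.sum_congr rfl fun I hI => ?_
      rw [Finset.mem_powerset] at hI
      by_cases hr : I.card = r
      · have hc : (X \ I).card = k + 1 := by
          rw [Finset.card_sdiff_of_subset hI]; omega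
        rw [qFact_succ, ← hc, ← sum_prod_erase_div, Finset.mul_sum, Finset.sum_mul]
        refine Finset.sum_congr rfl fun a ha => ?_
        obtain ⟨haX, haI⟩ := Finset.mem_sdiff.1 ha
        have hIa : I ⊆ X.erase a := Finset.subset_erase.2 ⟨hI, haI⟩
        have h1 := splitCoeff_insert_right t hIa (Finset.notMem_erase a X)
        rw [Finset.insert_erase haX] at h1
        have h2 : (X.erase a) \ I = (X \ I).erase a := by
          ext j
          simp only [Finset.mem_sdiff, Finset.mem_erase]
          tauto
        rw [h1, ← Finset.prod_sdiff hIa, h2]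
        ring
      · rw [hlSym_eq_zero t mu hr]
        simp
    · intro a I
      simp only [Finset.mem_powerset, Finset.subset_erase, Finset.mem_sdiff]
      tauto

/-- `decomposeFin` splits off the first index while `hlSym` removes the last element. The order of
the indices is therefore reversed here, both in `mu` and in the quotients. -/
theorem sum_perm_eq_hlSym (t : L) {n : ℕ} (mu : Fin n → ℕ) {x : Fin n → L}
    (hx : Function.Injective x) :
    ∑ σ : Equiv.Perm (Fin n), (∏ i, x (σ i) ^ mu i) *
      ∏ i, ∏ j ∈ Finset.Ioi i, (x (σ j) - t * x (σ i)) / (x (σ j) - x (σ i)) =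
    hlSym t n (mu ∘ Fin.rev) (Finset.univ.image x) := by
  induction n with
  | zero => simp [hlSym]
  | succ n ih =>
    rw [hlSym, Finset.sum_image fun _ _ _ _ h => hx h,
      ← Equiv.Perm.decomposeFin.symm.sum_comp, Fintype.sum_prod_type]
    refine Finset.sum_congr rfl fun p _ => ?_
    set y : Fin n → L := fun i => x (Equiv.swap 0 p i.succ) with hy
    have hyi : Function.Injective y :=
      hx.comp ((Equiv.injective _).comp (Fin.succ_injective n))
    have him : Finset.univ.image y = (Finset.univ.image x).erase (x p) := by
      have h1 : (Fin.cons (x p) y : Fin (n + 1) → L) = x ∘ Equiv.swap 0 p := by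
        funext i
        refine Fin.cases ?_ (fun i => ?_) i
        · simp
        · simp [hy]
      have h2 : Finset.univ.image (x ∘ Equiv.swap 0 p) = Finset.univ.image x := by
        rw [← Finset.image_image, Finset.image_univ_equiv]
      rw [← h2, ← h1, image_cons, Finset.erase_insert]
      simp only [Finset.mem_image, Finset.mem_univ, true_and, not_exists]
      intro i hi
      have h3 := hx hi
      rw [Equiv.swap_apply_eq_iff, Equiv.swap_apply_right] at h3
      exact Fin.succ_ne_zero i h3
    have hrev : (mu ∘ Fin.rev) ∘ Fin.castSucc = (mu ∘ Fin.succ) ∘ Fin.rev := by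
      funext i
      simp [Fin.rev_castSucc]
    rw [hrev, ← him, ← ih (mu ∘ Fin.succ) hyi, Finset.mul_sum]
    refine Finset.sum_congr rfl fun e _ => ?_
    rw [Fin.prod_univ_succ, Fin.prod_univ_succ, Fin.prod_Ioi_zero,
      Finset.prod_image fun _ _ _ _ h => hyi h]
    simp only [Fin.prod_Ioi_succ, Equiv.Perm.decomposeFin_symm_apply_zero,
      Equiv.Perm.decomposeFin_symm_apply_succ, Function.comp_apply, Fin.rev_last]
    have h4 := Equiv.prod_comp e fun i => (y i - t * x p) / (y i - x p)
    rw [← h4]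
    simp only [hy]
    ring

end HlSym

/-! ### Comparison with the defining formula -/

section Symmetrization

theorem prod_Ioi_rev {M : Type*} [CommMonoid M] {n : ℕ} (f : Fin n → Fin n → M) :
    ∏ i, ∏ j ∈ Finset.Ioi i, f (Fin.rev i) (Fin.rev j) = ∏ i, ∏ j ∈ Finset.Ioi i, f j i := by
  have hR : ∏ i, ∏ j ∈ Finset.Ioi i, f j i = ∏ j, ∏ i ∈ Finset.Iio j, f j i :=
    Finset.prod_comm' (by simp)
  rw [hR, ← Equiv.prod_comp Fin.revPerm]
  refine Finset.prod_congr rfl fun i _ => ?_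
  rw [Fin.revPerm_apply, Fin.rev_rev]
  refine Finset.prod_nbij' Fin.rev Fin.rev ?_ ?_ (by simp) (by simp) (by simp)
  · intro j hj
    rw [Finset.mem_Ioi] at hj
    rwa [Finset.mem_Iio, ← Fin.rev_lt_rev, Fin.rev_rev]
  · intro j hj
    simpa using hj

theorem hlFormula_eq_hlSym {K L : Type*} [Field K] [Field L] [Algebra K L] [DecidableEq L] {n : ℕ}
    (t : K) (lam : PartitionLE n) {x : Fin n → L} (hx : Function.Injective x) :
    hlFormula t lam x = 1 / algebraMap K L (hlNorm t lam) *
      hlSym (algebraMap K L t) n lam.1 (Finset.univ.image x) := by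
  have h := sum_perm_eq_hlSym (algebraMap K L t) (lam.1 ∘ Fin.rev) hx
  have hrr : (lam.1 ∘ Fin.rev) ∘ Fin.rev = lam.1 := by
    funext i; simp
  rw [hrr] at h
  rw [hlFormula, ← h, ← Equiv.sum_comp (Equiv.mulRight Fin.revPerm)]
  congr 1
  refine Finset.sum_congr rfl fun σ _ => ?_
  congr 1
  · rw [← Equiv.prod_comp Fin.revPerm]
    simp
  · exact prod_Ioi_rev fun i j =>
      (x (σ i) - algebraMap K L t * x (σ j)) / (x (σ i) - x (σ j))

end Symmetrization

/-! ### Splitting off zero parts, and the truncated sums -/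

theorem extendParts_antitone (n : ℕ) {r : ℕ} {mu : Fin r → ℕ} (h : Antitone mu) :
    Antitone (extendParts n mu) := by
  intro i j hij
  unfold extendParts
  split_ifs with h1 h2
  · exact Nat.succ_le_succ (h (Fin.mk_le_mk.2 (Fin.le_def.1 hij)))
  · exact absurd (lt_of_le_of_lt (Fin.le_def.1 hij) h1) h2
  · exact Nat.zero_le _
  · exact le_rfl

/-- `extendParts` on partitions. -/
def extendPartition (n : ℕ) {r : ℕ} (mu : PartitionLE r) : PartitionLE n :=
  ⟨extendParts n mu.1, extendParts_antitone n mu.2⟩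

open Classical in
/-- The partitions with `n` parts, all of them less than `N`. -/
noncomputable def partsLT (N n : ℕ) : Finset (PartitionLE n) :=
  (Fintype.piFinset fun _ : Fin n => Finset.range N).subtype Antitone

/-- The sum of `A_lam(X) A_lam(Y) / v_lam` over the partitions `lam` with parts less than `N`, where
`A_lam` is the symmetrization `hlSym`. -/
noncomputable def hlPartialSum {L : Type*} [Field L] [DecidableEq L] (t : L) (N : ℕ)
    (X Y : Finset L) : L :=
  ∑ lam ∈ partsLT N X.card, hlSym t X.card lam.1 X * hlSym t X.card lam.1 Y / hlNorm t lam

section PartialSum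

theorem mem_partsLT {N n : ℕ} {lam : PartitionLE n} : lam ∈ partsLT N n ↔ ∀ i, lam.1 i < N := by
  simp [partsLT]

theorem partMult_extendPartition_zero {r k : ℕ} (mu : PartitionLE r) :
    partMult (extendPartition (r + k) mu) 0 = k := by
  rw [partMult, Finset.card_filter, Fin.sum_univ_add]
  simp [extendPartition, extendParts]

theorem partMult_extendPartition_succ {r k : ℕ} (mu : PartitionLE r) (i : ℕ) :
    partMult (extendPartition (r + k) mu) (i + 1) = partMult mu i := by
  rw [partMult, Finset.card_filter, Fin.sum_univ_add, partMult, Finset.card_filter]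
  simp [extendPartition, extendParts]

variable {L : Type*} [Field L]

theorem prod_Icc_sum_eq_qFact (t : L) (m : ℕ) :
    ∏ j ∈ Finset.Icc 1 m, ∑ k ∈ Finset.range j, t ^ k = qFact t m := by
  induction m with
  | zero => simp [qFact]
  | succ m ih => rw [Finset.prod_Icc_succ_top (by omega), ih, qFact_succ]; rfl

theorem hlNorm_eq_prod_range (t : L) {n : ℕ} (lam : PartitionLE n) {M : ℕ} (h : ∀ i, lam.1 i < M) :
    hlNorm t lam = ∏ i ∈ Finset.range M, qFact t (partMult lam i) := by
  simp only [hlNorm, prod_Icc_sum_eq_qFact]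
  refine Finset.prod_subset (fun i hi => ?_) fun i _ hi => ?_
  · obtain ⟨j, _, rfl⟩ := Finset.mem_image.1 hi
    exact Finset.mem_range.2 (h j)
  · have : partMult lam i = 0 := by
      rw [partMult, Finset.card_eq_zero, Finset.filter_eq_empty_iff]
      intro j _ hj
      exact hi (Finset.mem_image.2 ⟨j, Finset.mem_univ j, hj⟩)
    rw [this]
    rfl

theorem hlNorm_extendPartition (t : L) {r k : ℕ} (mu : PartitionLE r) :
    hlNorm t (extendPartition (r + k) mu) = qFact t k * hlNorm t mu := by
  obtain ⟨M, hM⟩ : ∃ M, ∀ i, mu.1 i < M :=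
    ⟨∑ i, mu.1 i + 1, fun i => Nat.lt_succ_of_le
      (Finset.single_le_sum (fun _ _ => Nat.zero_le _) (Finset.mem_univ i))⟩
  rw [hlNorm_eq_prod_range t mu hM, hlNorm_eq_prod_range t (M := M + 1), Finset.prod_range_succ',
    partMult_extendPartition_zero, mul_comm]
  · simp only [partMult_extendPartition_succ]
  · intro i
    simp only [extendPartition, extendParts]
    split_ifs
    · exact Nat.succ_lt_succ (hM _)
    · exact Nat.succ_pos M

theorem qFact_ne_zero {t : L} {n m : ℕ} (ht : ∀ j ∈ Finset.Icc 1 n, qNat t j ≠ 0) (hm : m ≤ n) :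
    qFact t m ≠ 0 :=
  Finset.prod_ne_zero_iff.2 fun j hj => ht _ (by
    rw [Finset.mem_range] at hj
    rw [Finset.mem_Icc]
    omega)

theorem hlNorm_ne_zero {t : L} {n : ℕ} (ht : ∀ j ∈ Finset.Icc 1 n, qNat t j ≠ 0)
    (lam : PartitionLE n) : hlNorm t lam ≠ 0 := by
  simp only [hlNorm, prod_Icc_sum_eq_qFact]
  refine Finset.prod_ne_zero_iff.2 fun i _ => qFact_ne_zero ht ?_
  exact (Finset.card_filter_le _ _).trans (by simp)

/-- Partitions with `n` parts less than `N + 1` correspond to partitions with at most `n` parts less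
than `N`. -/
theorem sum_partsLT_succ (N n : ℕ) (g : PartitionLE n → L) :
    ∑ lam ∈ partsLT (N + 1) n, g lam =
      ∑ r ∈ Finset.range (n + 1), ∑ mu ∈ partsLT N r, g (extendPartition n mu) := by
  rw [Finset.sum_sigma']
  symm
  refine Finset.sum_bij (fun p _ => extendPartition n p.2) ?_ ?_ ?_ (fun _ _ => rfl)
  · rintro ⟨r, mu⟩ hp
    rw [Finset.mem_sigma, mem_partsLT] at hp
    rw [mem_partsLT]
    intro i
    simp only [extendPartition, extendParts]
    split_ifs
    · exact Nat.succ_lt_succ (hp.2 _)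
    · exact Nat.succ_pos N
  · rintro ⟨r, mu⟩ hp ⟨r', mu'⟩ hp' h
    rw [Finset.mem_sigma, Finset.mem_range] at hp hp'
    obtain ⟨k, hk⟩ := Nat.exists_eq_add_of_le (Nat.le_of_lt_succ hp.1)
    obtain ⟨k', hk'⟩ := Nat.exists_eq_add_of_le (Nat.le_of_lt_succ hp'.1)
    dsimp only at hk hk' h
    have hfun : ∀ i : Fin n, extendParts n mu.1 i = extendParts n mu'.1 i := fun i =>
      congrFun (congrArg Subtype.val h) i
    have hrr : r = r' := by
      rcases lt_trichotomy r r' with hlt | heq | hlt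
      · have := hfun ⟨r, by omega⟩
        simp [extendParts, hlt] at this
      · exact heq
      · have := hfun ⟨r', by omega⟩
        simp [extendParts, hlt] at this
    subst hrr
    congr 1
    refine Subtype.ext (funext fun i => ?_)
    have := hfun ⟨i, by omega⟩
    simpa [extendParts] using this
  · intro lam hlam
    rw [mem_partsLT] at hlam
    -- The number of nonzero parts; by monotonicity these occupy exactly the first `r` positions.
    set r := (Finset.univ.filter fun i : Fin n => 0 < lam.1 i).card with hr
    have hrn : r ≤ n := (Finset.card_filter_le _ _).trans (by simp)
    have hiff : ∀ i : Fin n, (i : ℕ) < r ↔ 0 < lam.1 i := by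
      intro i
      constructor
      · intro hi
        by_contra h0
        have hsub : (Finset.univ.filter fun i : Fin n => 0 < lam.1 i) ⊆ Finset.Iio i := by
          intro j hj
          rw [Finset.mem_filter] at hj
          rw [Finset.mem_Iio]
          by_contra hji
          exact h0 (lt_of_lt_of_le hj.2 (lam.2 (not_lt.1 hji)))
        have := Finset.card_le_card hsub
        rw [Fin.card_Iio] at this
        omega
      · intro hi
        have hsub : Finset.Iic i ⊆ Finset.univ.filter fun i : Fin n => 0 < lam.1 i := by
          intro j hj
          rw [Finset.mem_Iic] at hj
          exact Finset.mem_filter.2 ⟨Finset.mem_univ j, lt_of_lt_of_le hi (lam.2 hj)⟩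
        have := Finset.card_le_card hsub
        rw [Fin.card_Iic] at this
        omega
    refine ⟨⟨r, ⟨fun i => lam.1 (Fin.castLE hrn i) - 1, fun i j hij =>
      Nat.sub_le_sub_right (lam.2 (Fin.le_def.2 (Fin.le_def.1 hij))) 1⟩⟩, ?_, ?_⟩
    · rw [Finset.mem_sigma, Finset.mem_range, mem_partsLT]
      refine ⟨Nat.lt_succ_of_le hrn, fun i => ?_⟩
      have h1 := hlam (Fin.castLE hrn i)
      have h2 := (hiff (Fin.castLE hrn i)).1 i.2
      dsimp only
      omega
    · refine Subtype.ext (funext fun i => ?_)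
      simp only [extendPartition, extendParts]
      split_ifs with h
      · have := (hiff i).1 h
        change lam.1 i - 1 + 1 = lam.1 i
        omega
      · have : ¬ 0 < lam.1 i := fun h' => h ((hiff i).2 h')
        omega

variable [DecidableEq L]

/-- The two symmetrizations give `[k]!` twice and the denominator contains it once, so one `[k]!`
remains. Lowering each nonzero part by one lowers the bound `N` by one, and for given `I` only `r =
I.card` contributes. -/
theorem hlPartialSum_succ {t : L} (N : ℕ) {X Y : Finset L} (h : Y.card = X.card)
    (ht : ∀ j ∈ Finset.Icc 1 X.card, qNat t j ≠ 0) :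
    hlPartialSum t (N + 1) X Y = hlSum t (qFact t) (hlPartialSum t N) X Y := by
  have step : ∀ r ∈ Finset.range (X.card + 1), ∀ mu ∈ partsLT N r,
      hlSym t X.card (extendPartition X.card mu).1 X *
        hlSym t X.card (extendPartition X.card mu).1 Y / hlNorm t (extendPartition X.card mu) =
      ∑ I ∈ X.powerset, ∑ J ∈ Y.powerset, qFact t (X.card - r) *
        (splitCoeff t I X * splitCoeff t J Y) * ((∏ i ∈ I, i) * ∏ j ∈ J, j) *
          (hlSym t r mu.1 I * hlSym t r mu.1 J / hlNorm t mu) := by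
    intro r hr mu _
    rw [Finset.mem_range] at hr
    obtain ⟨k, hk⟩ := Nat.exists_eq_add_of_le (Nat.le_of_lt_succ hr)
    have hq : qFact t k ≠ 0 := qFact_ne_zero ht (by omega)
    rw [hk] at h ⊢
    rw [hlNorm_extendPartition]
    simp only [extendPartition]
    rw [hlSym_extendParts t mu.1 k hk, hlSym_extendParts t mu.1 k h, Nat.add_sub_cancel_left,
      mul_mul_mul_comm, Finset.sum_mul_sum, mul_div_mul_comm, mul_div_assoc, div_self hq, mul_one,
      Finset.sum_div, Finset.mul_sum]
    refine Finset.sum_congr rfl fun I _ => ?_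
    rw [Finset.sum_div, Finset.mul_sum]
    exact Finset.sum_congr rfl fun J _ => by ring
  rw [hlPartialSum, sum_partsLT_succ,
    Finset.sum_congr rfl fun r hr => Finset.sum_congr rfl (step r hr), hlSum]
  simp only [hlPartialSum, Finset.mul_sum]
  rw [Finset.sum_congr rfl fun r _ => Finset.sum_comm, Finset.sum_comm]
  refine Finset.sum_congr rfl fun I hI => ?_
  rw [Finset.mem_powerset] at hI
  rw [Finset.sum_congr rfl fun r _ => Finset.sum_comm, Finset.sum_comm]
  refine Finset.sum_congr rfl fun J _ => ?_
  rw [Finset.sum_eq_single_of_mem I.card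
    (Finset.mem_range.2 (Nat.lt_succ_of_le (Finset.card_le_card hI)))]
  · rw [Finset.card_sdiff_of_subset hI]
  · intro r _ hr
    refine Finset.sum_eq_zero fun mu _ => ?_
    rw [hlSym_eq_zero t mu.1 (Ne.symm hr)]
    simp

end PartialSum

/-! ### The order filtration on the field of fractions -/

/-- A quotient `a / d` of power series with `order a - order d ≥ m`. -/
def FracOrderGE {σ K : Type*} [Field K] (m : ℤ) (f : FractionRing (MvPowerSeries σ K)) : Prop :=
  ∃ a d : MvPowerSeries σ K, ∃ e k : ℕ,
    f * algebraMap (MvPowerSeries σ K) (FractionRing (MvPowerSeries σ K)) d =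
      algebraMap (MvPowerSeries σ K) (FractionRing (MvPowerSeries σ K)) a ∧
    d.order = e ∧ (k : ℕ∞) ≤ a.order ∧ m + e ≤ k

namespace FracOrderGE

variable {σ K : Type*} [Field K] {m m' : ℤ} {f g : FractionRing (MvPowerSeries σ K)}

theorem mono (h : FracOrderGE m f) (hm : m' ≤ m) : FracOrderGE m' f := by
  obtain ⟨a, d, e, k, h1, h2, h3, h4⟩ := h
  exact ⟨a, d, e, k, h1, h2, h3, by omega⟩

theorem of_algebraMap (s : MvPowerSeries σ K) {k : ℕ} (h : (k : ℕ∞) ≤ s.order) :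
    FracOrderGE (k : ℤ) (algebraMap (MvPowerSeries σ K) (FractionRing (MvPowerSeries σ K)) s) :=
  ⟨s, 1, 0, k, by simp, by
    have h1 : (1 : MvPowerSeries σ K).order = 0 := by
      by_contra h0
      simpa using MvPowerSeries.order_ne_zero_iff_constCoeff_eq_zero.1 h0
    simpa using h1, h, by simp⟩

theorem of_algebraMap_zero (s : MvPowerSeries σ K) :
    FracOrderGE 0 (algebraMap (MvPowerSeries σ K) (FractionRing (MvPowerSeries σ K)) s) :=
  of_algebraMap s (k := 0) (by simp)

theorem mul (hf : FracOrderGE m f) (hg : FracOrderGE m' g) : FracOrderGE (m + m') (f * g) := by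
  obtain ⟨a, d, e, k, h1, h2, h3, h4⟩ := hf
  obtain ⟨a', d', e', k', h1', h2', h3', h4'⟩ := hg
  refine ⟨a * a', d * d', e + e', k + k', ?_, ?_, ?_, by push_cast; omega⟩
  · rw [map_mul, map_mul, mul_mul_mul_comm, h1, h1']
  · rw [MvPowerSeries.order_mul, h2, h2']; simp
  · rw [MvPowerSeries.order_mul]
    push_cast
    exact add_le_add h3 h3'

theorem add (hf : FracOrderGE m f) (hg : FracOrderGE m g) : FracOrderGE m (f + g) := by
  obtain ⟨a, d, e, k, h1, h2, h3, h4⟩ := hf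
  obtain ⟨a', d', e', k', h1', h2', h3', h4'⟩ := hg
  refine ⟨a * d' + a' * d, d * d', e + e', min (k + e') (k' + e), ?_, ?_, ?_,
    by push_cast; omega⟩
  · rw [map_add, map_mul, map_mul, map_mul, ← h1, ← h1']
    ring
  · rw [MvPowerSeries.order_mul, h2, h2']; simp
  · refine le_trans ?_ MvPowerSeries.min_order_le_add
    rw [MvPowerSeries.order_mul, MvPowerSeries.order_mul, h2, h2']
    exact min_le_min (add_le_add h3 le_rfl) (add_le_add h3' le_rfl)

theorem zero (m : ℤ) : FracOrderGE m (0 : FractionRing (MvPowerSeries σ K)) := by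
  have h := of_algebraMap (0 : MvPowerSeries σ K) (k := m.toNat) (by simp)
  rw [map_zero] at h
  exact h.mono (by omega)

theorem one : FracOrderGE 0 (1 : FractionRing (MvPowerSeries σ K)) := by
  simpa using of_algebraMap_zero (1 : MvPowerSeries σ K)

theorem neg (hf : FracOrderGE m f) : FracOrderGE m (-f) := by
  have h := (of_algebraMap_zero (-1 : MvPowerSeries σ K)).mul hf
  simpa using h

theorem sum {ι : Type*} {A : Finset ι} {F : ι → FractionRing (MvPowerSeries σ K)}
    (h : ∀ i ∈ A, FracOrderGE m (F i)) : FracOrderGE m (∑ i ∈ A, F i) :=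
  Finset.sum_induction _ _ (fun _ _ => add) (zero m) h

theorem prod {ι : Type*} {A : Finset ι} {F : ι → FractionRing (MvPowerSeries σ K)}
    (h : ∀ i ∈ A, FracOrderGE 0 (F i)) : FracOrderGE 0 (∏ i ∈ A, F i) :=
  Finset.prod_induction _ _ (fun _ _ ha hb => by simpa using ha.mul hb) one h

theorem pow {k : ℕ} (h : FracOrderGE 1 f) : FracOrderGE k (f ^ k) := by
  induction k with
  | zero => simpa using one
  | succ k ih => rw [pow_succ]; exact_mod_cast ih.mul h

theorem exists_of_frac (f : FractionRing (MvPowerSeries σ K)) : ∃ m, FracOrderGE m f := by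
  obtain ⟨a, d, hd, rfl⟩ := IsFractionRing.div_surjective (A := MvPowerSeries σ K) f
  have hd0 : d ≠ 0 := nonZeroDivisors.ne_zero hd
  have hd1 : algebraMap (MvPowerSeries σ K) (FractionRing (MvPowerSeries σ K)) d ≠ 0 := by
    rwa [Ne, FaithfulSMul.algebraMap_eq_zero_iff]
  refine ⟨-(d.order.toNat : ℤ), a, d, d.order.toNat, 0, div_mul_cancel₀ _ hd1,
    (MvPowerSeries.ne_zero_iff_order_finite.1 hd0).symm, by simp, by simp⟩

/-- Since the order of a product is the sum of the orders, passing to fractions does not change the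
filtration on power series. -/
theorem le_order {s : MvPowerSeries σ K} {k : ℕ}
    (h : FracOrderGE (k : ℤ)
      (algebraMap (MvPowerSeries σ K) (FractionRing (MvPowerSeries σ K)) s)) :
    (k : ℕ∞) ≤ s.order := by
  obtain ⟨a, d, e, l, h1, h2, h3, h4⟩ := h
  rw [← map_mul] at h1
  have h5 := IsFractionRing.injective (MvPowerSeries σ K) (FractionRing (MvPowerSeries σ K)) h1
  rw [← h5, MvPowerSeries.order_mul, h2] at h3
  have h6 : ((k + e : ℕ) : ℕ∞) ≤ s.order + e := le_trans (by exact_mod_cast h4) h3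
  push_cast at h6
  exact (ENat.add_le_add_iff_right (ENat.natCast_ne_top e)).1 h6

/-- The filtration is separated; this turns approximation to every order into equality. -/
theorem eq_zero_of_forall (h : ∀ m, FracOrderGE m f) : f = 0 := by
  obtain ⟨a, d, hd, rfl⟩ := IsFractionRing.div_surjective (A := MvPowerSeries σ K) f
  have hd0 : d ≠ 0 := nonZeroDivisors.ne_zero hd
  have hd1 : algebraMap (MvPowerSeries σ K) (FractionRing (MvPowerSeries σ K)) d ≠ 0 := by
    rwa [Ne, FaithfulSMul.algebraMap_eq_zero_iff]
  have ha : a = 0 := by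
    rw [← MvPowerSeries.order_eq_top_iff, ENat.eq_top_iff_forall_ge]
    intro k
    refine le_order ?_
    have h1 := (h k).mul (of_algebraMap_zero d)
    rwa [div_mul_cancel₀ _ hd1, add_zero] at h1
  rw [ha, map_zero, zero_div]

end FracOrderGE

/-! ### Weights, and Hall–Littlewood polynomials inside the field of fractions -/

section Transfer

/-- `1 - t^j = (1 - t) [j]`, and the multiplicities add up to `n`. -/
theorem hlWeight_eq {K : Type*} [Field K] {n : ℕ} (t : K) (lam : PartitionLE n) :
    hlWeight t lam = (1 - t) ^ n * hlNorm t lam := by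
  have h : ∀ i, ∏ j ∈ Finset.Icc 1 (partMult lam i), (1 - t ^ j) = (1 - t) ^ partMult lam i *
      ∏ j ∈ Finset.Icc 1 (partMult lam i), ∑ k ∈ Finset.range j, t ^ k := by
    intro i
    rw [Finset.prod_congr rfl fun j _ => (mul_neg_geom_sum t j).symm, Finset.prod_mul_distrib,
      Finset.prod_const, Nat.card_Icc, Nat.add_sub_cancel]
  have hn : ∑ i ∈ Finset.univ.image lam.1, partMult lam i = n := by
    have := Finset.card_eq_sum_card_image lam.1 Finset.univ
    rw [Finset.card_univ, Fintype.card_fin] at this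
    exact this.symm
  rw [hlWeight, hlNorm, Finset.prod_congr rfl fun i _ => h i, Finset.prod_mul_distrib,
    Finset.prod_pow_eq_pow_sum, hn]

theorem map_hlNorm {K L : Type*} [Field K] [Field L] (φ : K →+* L) {n : ℕ} (t : K)
    (lam : PartitionLE n) : φ (hlNorm t lam) = hlNorm (φ t) lam := by
  simp [hlNorm]

theorem map_qNat {K L : Type*} [Field K] [Field L] (φ : K →+* L) (t : K) (k : ℕ) :
    φ (qNat t k) = qNat (φ t) k := by
  simp [qNat]

theorem map_hlFormula {K L M : Type*} [Field K] [Field L] [Algebra K L] [Field M] [Algebra K M]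
    (φ : L →+* M) (hφ : ∀ s : K, φ (algebraMap K L s) = algebraMap K M s) {n : ℕ} (t : K)
    (lam : PartitionLE n) (x : Fin n → L) :
    φ (hlFormula t lam x) = hlFormula t lam (φ ∘ x) := by
  simp [hlFormula, hφ]

theorem izerginForm_eq {L : Type*} [Field L] {n : ℕ} (t : L) (x y : Fin n → L) :
    izerginForm t x y = (1 - t) ^ n * izRatio t 0 x y := by
  have h : (Matrix.of fun i j : Fin n => (1 - t) / ((1 - x i * y j) * (1 - t * x i * y j))) =
      (1 - t) • Matrix.of fun i j : Fin n => izEntry t 0 (x i * y j) := by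
    ext i j
    simp [izEntry, qNat, mul_assoc, div_eq_mul_inv]
  rw [izerginForm, h, Matrix.det_smul, Fintype.card_fin, izRatio]
  ring

variable {K : Type*} [Field K] {n : ℕ}

theorem algebraMap_eq_algebraMap_C (s : K) :
    algebraMap K (FracXY K n) s = algebraMap (SeriesXY K n) (FracXY K n) (MvPowerSeries.C s) := by
  rw [IsScalarTower.algebraMap_apply K (SeriesXY K n) (FracXY K n)]
  rfl

/-- The defining property lives in the field of rational functions. The injection of polynomials
into power series extends to the fraction fields and carries the formula along. -/
theorem algebraMap_hallLittlewood (t : K) (lam : PartitionLE n)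
    (e : Fin n → Fin n ⊕ Fin n) (he : Function.Injective e) :
    algebraMap (SeriesXY K n) (FracXY K n)
      ((MvPolynomial.rename e (hallLittlewood t lam) : MvPolynomial (Fin n ⊕ Fin n) K) :
        SeriesXY K n) =
    hlFormula t lam fun i =>
      algebraMap (SeriesXY K n) (FracXY K n) (MvPowerSeries.X (e i)) := by
  let g : MvPolynomial (Fin n) K →+* FracXY K n :=
    (algebraMap (SeriesXY K n) (FracXY K n)).comp
      (MvPolynomial.coeToMvPowerSeries.ringHom.comp (MvPolynomial.rename e).toRingHom)
  have hg : Function.Injective g := by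
    refine (IsFractionRing.injective (SeriesXY K n) (FracXY K n)).comp ?_
    exact (MvPolynomial.coe_injective (Fin n ⊕ Fin n) K).comp (MvPolynomial.rename_injective e he)
  let φ : FractionRing (MvPolynomial (Fin n) K) →+* FracXY K n := IsFractionRing.lift hg
  have hφ : ∀ p, φ (algebraMap _ _ p) = g p := fun p => IsFractionRing.lift_algebraMap hg p
  have h := congrArg φ (hallLittlewood_spec t lam)
  rw [hφ, map_hlFormula φ] at h
  · refine h.trans ?_
    congr 1
    funext i
    rw [Function.comp_apply, hφ]
    simp [g]
  · intro s
    rw [IsScalarTower.algebraMap_apply K (MvPolynomial (Fin n) K), hφ, algebraMap_eq_algebraMap_C]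
    simp [g, MvPolynomial.algebraMap_eq]

end Transfer

section Variables

variable (K : Type*) [Field K] {n : ℕ}

theorem xVar_injective : Function.Injective (xVar K : Fin n → FracXY K n) := fun i j h => by
  have h1 := IsFractionRing.injective (SeriesXY K n) (FracXY K n) h
  exact Sum.inl_injective (MvPowerSeries.X_inj.1 h1)

theorem yVar_injective : Function.Injective (yVar K : Fin n → FracXY K n) := fun i j h => by
  have h1 := IsFractionRing.injective (SeriesXY K n) (FracXY K n) h
  exact Sum.inr_injective (MvPowerSeries.X_inj.1 h1)

variable {K}

theorem fracOrderGE_X (c : Fin n ⊕ Fin n) :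
    FracOrderGE 1 (algebraMap (SeriesXY K n) (FracXY K n) (MvPowerSeries.X c)) := by
  have h := FracOrderGE.of_algebraMap (MvPowerSeries.X c : SeriesXY K n) (k := 1) (by
    rw [Nat.cast_one, MvPowerSeries.one_le_order_iff_constCoeff_eq_zero]
    simp)
  exact_mod_cast h

/-- The quotient need not be a power series, but its denominator has order exactly `1` and its
numerator order at least `1`. This is why orders are measured in the field of fractions. -/
theorem fracOrderGE_ratio (t : K) {c d : Fin n ⊕ Fin n} (hcd : c ≠ d) :
    FracOrderGE 0
      ((algebraMap (SeriesXY K n) (FracXY K n) (MvPowerSeries.X c) -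
        tConst n t * algebraMap (SeriesXY K n) (FracXY K n) (MvPowerSeries.X d)) /
      (algebraMap (SeriesXY K n) (FracXY K n) (MvPowerSeries.X c) -
        algebraMap (SeriesXY K n) (FracXY K n) (MvPowerSeries.X d))) := by
  have hne : (MvPowerSeries.X c - MvPowerSeries.X d : SeriesXY K n) ≠ 0 :=
    sub_ne_zero.2 fun h => hcd (MvPowerSeries.X_inj.1 h)
  refine ⟨MvPowerSeries.X c - MvPowerSeries.C t * MvPowerSeries.X d,
    MvPowerSeries.X c - MvPowerSeries.X d, 1, 1, ?_, ?_, ?_, by simp⟩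
  · rw [map_sub, map_sub, map_mul, div_mul_cancel₀]
    · rfl
    · rw [← map_sub, Ne, FaithfulSMul.algebraMap_eq_zero_iff]
      exact hne
  · refine le_antisymm ?_ ?_
    · have h := MvPowerSeries.order_le (f := (MvPowerSeries.X c - MvPowerSeries.X d : SeriesXY K n))
        (d := Finsupp.single c 1) (by
          rw [map_sub, MvPowerSeries.coeff_X, MvPowerSeries.coeff_X, if_pos rfl, if_neg]
          · simp
          · rw [Finsupp.single_left_inj one_ne_zero]
            exact hcd)
      simpa using h
    · rw [Nat.cast_one, MvPowerSeries.one_le_order_iff_constCoeff_eq_zero]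
      simp
  · rw [Nat.cast_one, MvPowerSeries.one_le_order_iff_constCoeff_eq_zero]
    simp

end Variables

/-! ### Convergence of the truncated sums to the closed form -/

section Estimates

theorem fracOrderGE_qFact {σ K : Type*} [Field K] {t : FractionRing (MvPowerSeries σ K)}
    (ht : FracOrderGE 0 t) (k : ℕ) : FracOrderGE 0 (qFact t k) :=
  FracOrderGE.prod fun j _ => FracOrderGE.sum fun i _ => by
    rw [← Finset.card_range i, ← Finset.prod_const]
    exact FracOrderGE.prod fun _ _ => ht

variable {σ K : Type*} [Field K] [DecidableEq (FractionRing (MvPowerSeries σ K))]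
  {t : FractionRing (MvPowerSeries σ K)} {X Y : Finset (FractionRing (MvPowerSeries σ K))}

theorem fracOrderGE_splitCoeff
    (hr : ∀ a ∈ X, ∀ b ∈ X, a ≠ b → FracOrderGE 0 ((a - t * b) / (a - b)))
    {I : Finset (FractionRing (MvPowerSeries σ K))} (hI : I ⊆ X) :
    FracOrderGE 0 (splitCoeff t I X) :=
  FracOrderGE.prod fun i hi => FracOrderGE.prod fun j hj =>
    hr i (hI hi) j (Finset.mem_sdiff.1 hj).1 fun h => (Finset.mem_sdiff.1 hj).2 (h ▸ hi)

theorem fracOrderGE_hlSym (h1 : ∀ a ∈ X, FracOrderGE 1 a)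
    (hr : ∀ a ∈ X, ∀ b ∈ X, a ≠ b → FracOrderGE 0 ((a - t * b) / (a - b))) {n : ℕ}
    (lam : Fin n → ℕ) : FracOrderGE (∑ i, lam i : ℕ) (hlSym t n lam X) := by
  induction n generalizing X with
  | zero =>
    simp only [hlSym, Finset.univ_eq_empty, Finset.sum_empty, Nat.cast_zero]
    split_ifs
    · exact FracOrderGE.one
    · exact FracOrderGE.zero 0
  | succ n ih =>
    refine FracOrderGE.sum fun a ha => ?_
    have hp : FracOrderGE 0 (∏ j ∈ X.erase a, (j - t * a) / (j - a)) :=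
      FracOrderGE.prod fun j hj => hr j (Finset.mem_of_mem_erase hj) a ha (Finset.ne_of_mem_erase hj)
    have h := (((h1 a ha).pow (k := lam (Fin.last n))).mul hp).mul
      (ih (X := X.erase a) (fun b hb => h1 b (Finset.mem_of_mem_erase hb))
        (fun b hb c hc => hr b (Finset.mem_of_mem_erase hb) c (Finset.mem_of_mem_erase hc))
        (lam ∘ Fin.castSucc))
    refine h.mono ?_
    rw [Fin.sum_univ_castSucc]
    simp only [Function.comp_apply]
    push_cast
    omega

theorem hlPartialSum_empty {L : Type*} [Field L] [DecidableEq L] (t : L) (N : ℕ) :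
    hlPartialSum t N (∅ : Finset L) ∅ = 1 := by
  have key : ∀ n, n = 0 → ∑ lam ∈ partsLT N n,
      hlSym t n lam.1 (∅ : Finset L) * hlSym t n lam.1 ∅ / hlNorm t lam = 1 := by
    rintro n rfl
    have h : partsLT N 0 = {⟨Fin.elim0, fun i => Fin.elim0 i⟩} := by
      ext lam
      simp only [mem_partsLT, Finset.mem_singleton]
      exact ⟨fun _ => Subtype.ext (funext fun i => Fin.elim0 i), fun _ i => Fin.elim0 i⟩
    rw [h, Finset.sum_singleton, hlNorm_eq_prod_range t _ (M := 0) fun i => Fin.elim0 i]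
    simp [hlSym]
  exact key _ Finset.card_empty

/-- The partial sums of the Hall–Littlewood sum approach the determinantal closed form. -/
theorem exists_fracOrderGE_izFin_sub (ht : FracOrderGE 0 t)
    (hq : ∀ j ∈ Finset.Icc 1 X.card, qNat t j ≠ 0)
    (hX1 : ∀ a ∈ X, FracOrderGE 1 a) (hY1 : ∀ a ∈ Y, FracOrderGE 1 a)
    (hXr : ∀ a ∈ X, ∀ b ∈ X, a ≠ b → FracOrderGE 0 ((a - t * b) / (a - b)))
    (hYr : ∀ a ∈ Y, ∀ b ∈ Y, a ≠ b → FracOrderGE 0 ((a - t * b) / (a - b)))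
    (h1 : ∀ p ∈ X, ∀ b ∈ Y, 1 - p * b ≠ 0) (h2 : ∀ p ∈ X, ∀ b ∈ Y, 1 - t * (p * b) ≠ 0) :
    ∃ m : ℤ, ∀ N : ℕ, ∀ I ⊆ X, ∀ J ⊆ Y,
      FracOrderGE (m + N) (izFin t 0 I J - hlPartialSum t N I J) := by
  choose f hf using FracOrderGE.exists_of_frac (σ := σ) (K := K)
  -- One bound for all pairs of subsets at `N = 0`, since the recurrence passes to subsets.
  obtain ⟨m, hm⟩ := ((X.powerset ×ˢ Y.powerset).image fun p =>
    -f (izFin t 0 p.1 p.2 - hlPartialSum t 0 p.1 p.2)).exists_le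
  refine ⟨-m, fun N => ?_⟩
  induction N with
  | zero =>
    intro I hI J hJ
    refine (hf _).mono ?_
    rw [Nat.cast_zero, add_zero]
    exact neg_le.1 (hm _ (Finset.mem_image.2 ⟨(I, J), Finset.mem_product.2
      ⟨Finset.mem_powerset.2 hI, Finset.mem_powerset.2 hJ⟩, rfl⟩))
  | succ N ih =>
    intro X' hX' Y' hY'
    by_cases hc : Y'.card = X'.card
    · have e1 := hlSum_izFin t 0 hc (fun p hp b hb => h1 p (hX' hp) b (hY' hb))
        (fun p hp b hb => h2 p (hX' hp) b (hY' hb))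
      have e2 := hlPartialSum_succ N hc (t := t) fun j hj => hq j (by
        have := Finset.card_le_card hX'
        rw [Finset.mem_Icc] at hj ⊢
        omega)
      have e3 : qFact t 0 = 1 := rfl
      rw [e3, one_mul] at e1
      rw [← e1, e2, hlSum, hlSum, ← Finset.sum_sub_distrib]
      refine FracOrderGE.sum fun I hI => ?_
      rw [Finset.mem_powerset] at hI
      rw [← Finset.sum_sub_distrib]
      refine FracOrderGE.sum fun J hJ => ?_
      rw [Finset.mem_powerset] at hJ
      rw [add_zero, ← mul_sub]
      -- For empty `I` nothing is gained from `∏ I`, but the two functions agree there exactly.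
      rcases I.eq_empty_or_nonempty with rfl | ⟨a, ha⟩
      · have : izFin t 0 ∅ J - hlPartialSum t N ∅ J = 0 := by
          rcases J.eq_empty_or_nonempty with rfl | hJn
          · rw [izFin_empty, hlPartialSum_empty, sub_self]
          · have hJc := Finset.card_pos.2 hJn
            rw [izFin_eq_zero t 0 (by simpa using hJn.ne_empty), hlPartialSum,
              Finset.sum_eq_zero, sub_self]
            intro lam _
            rw [hlSym_eq_zero t lam.1 (X := J) (by simpa using hJn.ne_empty), mul_zero, zero_div]
        rw [this, mul_zero]
        exact FracOrderGE.zero _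
      · have hsX := fracOrderGE_splitCoeff
          (fun a ha b hb => hXr a (hX' ha) b (hX' hb)) hI
        have hsY := fracOrderGE_splitCoeff
          (fun a ha b hb => hYr a (hY' ha) b (hY' hb)) hJ
        -- This factor supplies the one order gained in passing from `N` to `N + 1`.
        have hpI : FracOrderGE 1 (∏ i ∈ I, i) := by
          rw [← Finset.mul_prod_erase I _ ha]
          simpa using (hX1 a (hX' (hI ha))).mul (FracOrderGE.prod fun i hi =>
            (hX1 i (hX' (hI (Finset.mem_of_mem_erase hi)))).mono zero_le_one)
        have hpJ : FracOrderGE 0 (∏ j ∈ J, j) := FracOrderGE.prod fun j hj =>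
          (hY1 j (hY' (hJ hj))).mono zero_le_one
        refine ((((fracOrderGE_qFact ht _).mul (hsX.mul hsY)).mul (hpI.mul hpJ)).mul
          (ih I (hI.trans hX') J (hJ.trans hY'))).mono ?_
        push_cast
        omega
    · rw [izFin_eq_zero t 0 hc, hlPartialSum, Finset.sum_eq_zero, sub_self]
      · exact FracOrderGE.zero _
      · intro lam _
        rw [hlSym_eq_zero t lam.1 hc, mul_zero, zero_div]

end Estimates

/-! ### Conclusion in the power series ring -/

theorem theorem2 {K : Type*} [Field K] [TopologicalSpace K] [DiscreteTopology K] (n : ℕ) (t : K)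
    (ht : ∀ j ∈ Finset.Icc 1 n, ∑ k ∈ Finset.range j, t ^ k ≠ 0) :
    ∃ S : SeriesXY K n,
      HasSum
        (fun lam : PartitionLE n =>
          MvPowerSeries.C (hlWeight t lam) *
            inX (hallLittlewood t lam) * inY (hallLittlewood t lam)) S ∧
      algebraMap (SeriesXY K n) (FracXY K n) S = izerginForm (tConst n t) (xVar K) (yVar K) := by
  classical
  set ψ := algebraMap (SeriesXY K n) (FracXY K n) with hψ
  set T : PartitionLE n → SeriesXY K n := fun lam => MvPowerSeries.C (hlWeight t lam) *
    inX (hallLittlewood t lam) * inY (hallLittlewood t lam) with hT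
  set X : Finset (FracXY K n) := Finset.univ.image (xVar K) with hX
  set Y : Finset (FracXY K n) := Finset.univ.image (yVar K) with hY
  have hXc : X.card = n := by
    rw [hX, Finset.card_image_of_injective _ (xVar_injective K), Finset.card_univ, Fintype.card_fin]
  let φ : K →+* FracXY K n := ψ.comp MvPowerSeries.C
  have hφ : φ t = tConst n t := rfl
  have hK : algebraMap K (FracXY K n) = φ := RingHom.ext algebraMap_eq_algebraMap_C
  have ht0 : FracOrderGE 0 (tConst n t) := FracOrderGE.of_algebraMap_zero _
  have hq : ∀ j ∈ Finset.Icc 1 n, qNat (tConst n t) j ≠ 0 := by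
    intro j hj
    rw [← hφ, ← map_qNat, Ne, map_eq_zero]
    exact ht j hj
  have hmX : ∀ a ∈ X, ∃ i, xVar K i = a := fun a ha => by simpa [hX] using ha
  have hmY : ∀ a ∈ Y, ∃ i, yVar K i = a := fun a ha => by simpa [hY] using ha
  have hX1 : ∀ a ∈ X, FracOrderGE 1 a := fun a ha => by
    obtain ⟨i, rfl⟩ := hmX a ha
    exact fracOrderGE_X _
  have hY1 : ∀ a ∈ Y, FracOrderGE 1 a := fun a ha => by
    obtain ⟨i, rfl⟩ := hmY a ha
    exact fracOrderGE_X _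
  have hXr : ∀ a ∈ X, ∀ b ∈ X, a ≠ b → FracOrderGE 0 ((a - tConst n t * b) / (a - b)) := by
    intro a ha b hb hab
    obtain ⟨i, rfl⟩ := hmX a ha
    obtain ⟨j, rfl⟩ := hmX b hb
    exact fracOrderGE_ratio t fun h => hab (by rw [Sum.inl_injective h])
  have hYr : ∀ a ∈ Y, ∀ b ∈ Y, a ≠ b → FracOrderGE 0 ((a - tConst n t * b) / (a - b)) := by
    intro a ha b hb hab
    obtain ⟨i, rfl⟩ := hmY a ha
    obtain ⟨j, rfl⟩ := hmY b hb
    exact fracOrderGE_ratio t fun h => hab (by rw [Sum.inr_injective h])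
  have hunit : ∀ s : SeriesXY K n, MvPowerSeries.constantCoeff s = 0 → 1 - ψ s ≠ 0 := by
    intro s hs h
    rw [← map_one ψ, ← map_sub, hψ, FaithfulSMul.algebraMap_eq_zero_iff] at h
    have := congrArg MvPowerSeries.constantCoeff h
    simp [hs] at this
  have h1 : ∀ p ∈ X, ∀ b ∈ Y, 1 - p * b ≠ 0 := by
    intro p hp b hb
    obtain ⟨i, rfl⟩ := hmX p hp
    obtain ⟨j, rfl⟩ := hmY b hb
    have := hunit (MvPowerSeries.X (Sum.inl i) * MvPowerSeries.X (Sum.inr j)) (by simp)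
    rwa [map_mul] at this
  have h2 : ∀ p ∈ X, ∀ b ∈ Y, 1 - tConst n t * (p * b) ≠ 0 := by
    intro p hp b hb
    obtain ⟨i, rfl⟩ := hmX p hp
    obtain ⟨j, rfl⟩ := hmY b hb
    have := hunit (MvPowerSeries.C t *
      (MvPowerSeries.X (Sum.inl i) * MvPowerSeries.X (Sum.inr j))) (by simp)
    rwa [map_mul, map_mul] at this
  -- The weight contributes `(1 - t)^n v_λ`, the two polynomials `1 / v_λ` each.
  have hterm : ∀ lam, ψ (T lam) = (1 - tConst n t) ^ n *
      (hlSym (tConst n t) n lam.1 X * hlSym (tConst n t) n lam.1 Y / hlNorm (tConst n t) lam) := by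
    intro lam
    have hx := (algebraMap_hallLittlewood t lam Sum.inl Sum.inl_injective).trans
      (hlFormula_eq_hlSym t lam (xVar_injective K))
    have hy := (algebraMap_hallLittlewood t lam Sum.inr Sum.inr_injective).trans
      (hlFormula_eq_hlSym t lam (yVar_injective K))
    have hw : ψ (MvPowerSeries.C (hlWeight t lam)) =
        (1 - tConst n t) ^ n * hlNorm (tConst n t) lam := by
      change φ _ = _
      rw [hlWeight_eq, map_mul, map_pow, map_sub, map_one, map_hlNorm, hφ]
    have hv := hlNorm_ne_zero hq lam
    rw [hK, map_hlNorm, hφ] at hx hy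
    rw [hT, map_mul, map_mul, hw]
    unfold inX inY
    rw [hx, hy]
    field_simp
    rfl
  have hpow : FracOrderGE 0 ((1 - tConst n t) ^ n) := by
    rw [← map_one ψ, tConst, ← map_sub, ← map_pow]
    exact FracOrderGE.of_algebraMap_zero _
  -- The order of a term is at least the sum of the parts, so a partition with a part `≥ N` does not
  -- affect degrees below `N`.
  have hord : ∀ lam : PartitionLE n, ((∑ i, lam.1 i : ℕ) : ℕ∞) ≤ (T lam).order := by
    intro lam
    refine FracOrderGE.le_order ?_
    change FracOrderGE _ (ψ (T lam))
    have hinv : FracOrderGE 0 ((hlNorm (tConst n t) lam)⁻¹) := by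
      rw [← hφ, ← map_hlNorm, ← map_inv₀]
      exact FracOrderGE.of_algebraMap_zero _
    rw [hterm, div_eq_mul_inv]
    refine (hpow.mul (((fracOrderGE_hlSym hX1 hXr lam.1).mul
      (fracOrderGE_hlSym hY1 hYr lam.1)).mul hinv)).mono ?_
    omega
  have hzero : ∀ (d : (Fin n ⊕ Fin n) →₀ ℕ) (N : ℕ), d.degree < N →
      ∀ lam ∉ partsLT N n, MvPowerSeries.coeff d (T lam) = 0 := by
    intro d N hd lam hlam
    rw [mem_partsLT] at hlam
    push Not at hlam
    obtain ⟨i, hi⟩ := hlam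
    refine MvPowerSeries.coeff_of_lt_order (lt_of_lt_of_le ?_ (hord lam))
    have := Finset.single_le_sum (f := lam.1) (fun _ _ => Nat.zero_le _) (Finset.mem_univ i)
    exact_mod_cast lt_of_lt_of_le hd (hi.trans this)
  -- In degree `d.degree` only partitions with all parts at most `d.degree` matter, hence the bound
  -- `d.degree + 1`.
  let S : SeriesXY K n := fun d => ∑ lam ∈ partsLT (d.degree + 1) n, MvPowerSeries.coeff d (T lam)
  have hS : ∀ d, MvPowerSeries.coeff d S =
      ∑ lam ∈ partsLT (d.degree + 1) n, MvPowerSeries.coeff d (T lam) := fun d => rfl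
  refine ⟨S, ?_, ?_⟩
  · rw [MvPowerSeries.WithPiTopology.hasSum_iff_hasSum_coeff]
    intro d
    rw [hS]
    exact hasSum_sum_of_ne_finset_zero (hzero d _ (Nat.lt_succ_self _))
  · have hdiff : ∀ N : ℕ, FracOrderGE (N : ℤ) (ψ (S - ∑ lam ∈ partsLT N n, T lam)) := by
      intro N
      refine FracOrderGE.of_algebraMap _ (MvPowerSeries.nat_le_order fun d hd => ?_)
      rw [map_sub, map_sum, hS, sub_eq_zero]
      refine Finset.sum_subset (fun lam hlam => ?_)
        fun lam _ hlam => hzero d _ (Nat.lt_succ_self _) lam hlam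
      rw [mem_partsLT] at hlam ⊢
      exact fun i => lt_of_lt_of_le (hlam i) hd
    obtain ⟨m, hm⟩ := exists_fracOrderGE_izFin_sub ht0 (by rwa [hXc]) hX1 hY1 hXr hYr h1 h2
    have hpart : ∀ N, ψ (∑ lam ∈ partsLT N n, T lam) =
        (1 - tConst n t) ^ n * hlPartialSum (tConst n t) N X Y := by
      intro N
      rw [map_sum, hlPartialSum, hXc, Finset.mul_sum]
      exact Finset.sum_congr rfl fun lam _ => hterm lam
    have hclosed : izerginForm (tConst n t) (xVar K) (yVar K) =
        (1 - tConst n t) ^ n * izFin (tConst n t) 0 X Y := by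
      rw [izerginForm_eq, hX, hY, izFin_image _ _ (xVar_injective K) (yVar_injective K)]
    rw [← sub_eq_zero]
    refine FracOrderGE.eq_zero_of_forall fun l => ?_
    -- `N` is large enough for both errors: the tail of the series has order at least `N`, the
    -- distance of the partial sum from the closed form at least `m + N`.
    obtain ⟨N, hN1, hN2⟩ : ∃ N : ℕ, l ≤ N ∧ l ≤ m + N :=
      ⟨l.toNat + (-m).toNat, by omega, by omega⟩
    have e : ψ S - izerginForm (tConst n t) (xVar K) (yVar K) =
        ψ (S - ∑ lam ∈ partsLT N n, T lam) + -((1 - tConst n t) ^ n *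
          (izFin (tConst n t) 0 X Y - hlPartialSum (tConst n t) N X Y)) := by
      rw [map_sub, hpart, hclosed]
      ring
    rw [e]
    exact ((hdiff N).mono hN1).add
      ((hpow.mul (hm N X subset_rfl Y subset_rfl)).neg.mono (by omega))
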